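/- Let $A$ be a finite alphabet with the discrete topology, and give $A^{\mathbb{Z}^d}$ the product topology, its Borel $\sigma$-algebra and the shift action $(\sigma_t x)(s)=x(s+t)$, $s,t\in\mathbb{Z}^d$. A nearest neighbor $\mathbb{Z}^d$ shift of finite type (SFT) with alphabet $A$ is a nonempty set of the form $X=\{x\in A^{\mathbb{Z}^d} : (x(t),x(t+e_i))\notin F_i \text{ for all } t\in\mathbb{Z}^d,\ 1\le i\le d\}$ with $F_1,\dots,F_d\subseteq A\times A$. For finite $S\subset\mathbb{Z}^d$ let $L_S(X)=\{x|_S : x\in X\}$. The topological entropy of $X$ is $$h(X)=\lim_{n_1,\dots,n_d\to\infty}\frac{\log|L_{\prod_i[1,n_i]}(X)|}{n_1\cdots n_d},$$ and the entropy of a shift-invariant Borel probability measure $\mu$ on $A^{\mathbb{Z}^d}$ is $$h(\mu)=\lim_{n_1,\dots,n_d\to\infty}\frac{-1}{n_1\cdots n_d}\sum_{w\in A^{\prod_i[1,n_i]}}\mu([w])\log\mu([w]),$$ where $[w]$ is the set of points whose restriction to $\prod_i[1,n_i]$ is $w$, and $0\log 0=0$. A measure of maximal entropy on $X$ is a shift-invariant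 Borel probability measure $\mu$ with support contained in $X$ and $h(\mu)=h(X)$. Define $$\alpha_d=\inf\{\alpha\in\mathbb{R} : \text{there is a nearest neighbor } \mathbb{Z}^d \text{ SFT } X, \text{ with some finite alphabet } A, \text{ which has more than one measure of maximal entropy and satisfies } h(X)\ge\log|A|-\alpha\}.$$ For a positive integer $M$, the iceberg model $\mathcal{I}_M$ is the nearest neighbor $\mathbb{Z}^2$ SFT with alphabet $\{-M,\dots,-1,1,\dots,M\}$ in which two letters may occupy adjacent sites if and only if they have the same sign or they are $1$ and $-1$ (in either order). **Theorem.** The set defining $\alpha_2$ is nonempty and bounded below, and $\alpha_2<\log 2$; more precisely, $$\alpha_2\le\log 2-\frac{\log 2}{5\cdot 10^{20}}.$$ Moreover, $h(\mathcal{I}_M)\ge\log M+\dfrac{\log 2}{5M^5}$ for every integer $M\ge1$, and $\mathcal{I}_M$ has at least two distinct measures of maximal entropy for every integer $M>4e\cdot 28^2$ (in particular for $M=10^4$). -/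

import Mathlib

open Filter Topology MeasureTheory SymbolicDynamics.FullShift

noncomputable section

/-- The nearest neighbor `ℤ^d` shift of finite type over the alphabet `A` whose forbidden
configurations are the pairs of adjacent letters `F i ⊆ A^{0, e_i}`: the pair `(a, b) ∈ F i` must
not be seen at the sites `t, t + e_i`, for any `t`. -/
def nearestNeighborSFT {d : ℕ} {A : Type} [TopologicalSpace A] [DiscreteTopology A]
    (F : Fin d → Set (A × A)) : Subshift A (Fin d → ℤ) where
  carrier := {x | ∀ (i : Fin d) (t : Fin d → ℤ), (x t, x (t + Pi.single i 1)) ∉ F i}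
  isClosed := by
    simp only [Set.ofPred_forall]
    refine isClosed_iInter fun i => isClosed_iInter fun t => ?_
    have hc : Continuous fun x : (Fin d → ℤ) → A => (x t, x (t + Pi.single i 1)) := by fun_prop
    exact (isClosed_discrete (F i)ᶜ).preimage hc
  mapsTo := by
    intro t x hx i s
    have h := hx i (t + s)
    rw [add_assoc] at h
    exact h

/-- The box `[1, n_1] × ⋯ × [1, n_d]`. -/
def box {d : ℕ} (n : Fin d → ℕ) : Finset (Fin d → ℤ) :=
  Fintype.piFinset fun i => Finset.Icc (1 : ℤ) (n i)

/-- `L_S(X)`: the configurations of shape `S` that appear in points of `X`. -/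
def languageOfShape {d : ℕ} {A : Type} [TopologicalSpace A] (X : Subshift A (Fin d → ℤ))
    (S : Finset (Fin d → ℤ)) : Set (S → A) :=
  S.restrict '' X.carrier

/-- `h` is the topological entropy of `X`: the limit, as `n_1, …, n_d → ∞`, of
`log |L_{[1,n_1] × ⋯ × [1,n_d]}(X)| / (n_1 ⋯ n_d)` exists and equals `h`. -/
def HasTopologicalEntropy {d : ℕ} {A : Type} [TopologicalSpace A]
    (X : Subshift A (Fin d → ℤ)) (h : ℝ) : Prop :=
  Tendsto (fun n : Fin d → ℕ =>
    Real.log ((languageOfShape X (box n)).ncard : ℝ) / ∏ i, (n i : ℝ)) atTop (𝓝 h)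

/-- `h` is the measure-theoretic entropy of `μ`: the limit, as `n_1, …, n_d → ∞`, of
`-∑_w μ([w]) log μ([w]) / (n_1 ⋯ n_d)`, with `w` running over the configurations of shape
`[1,n_1] × ⋯ × [1,n_d]`, exists and equals `h` (here `Real.negMulLog p = -p log p`, which is `0`
for `p = 0`). -/
def HasMeasureEntropy {d : ℕ} {A : Type} [Fintype A] [MeasurableSpace A]
    (μ : Measure ((Fin d → ℤ) → A)) (h : ℝ) : Prop :=
  Tendsto (fun n : Fin d → ℕ =>
    (∑ w : box n → A, Real.negMulLog (μ.real {x | (box n).restrict x = w})) / ∏ i, (n i : ℝ))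
    atTop (𝓝 h)

/-- `μ` is a measure of maximal entropy on `X`: a shift-invariant Borel probability measure on the
full shift, with support contained in `X`, whose entropy equals the topological entropy of `X`. -/
structure IsMeasureOfMaximalEntropy {d : ℕ} {A : Type} [Fintype A] [TopologicalSpace A]
    [MeasurableSpace A] (X : Subshift A (Fin d → ℤ)) (μ : Measure ((Fin d → ℤ) → A)) : Prop where
  isProbabilityMeasure : IsProbabilityMeasure μ
  shift_invariant : ∀ t : Fin d → ℤ, MeasurePreserving (shift t) μ μ
  support_subset : μ.support ⊆ X.carrier
  entropy_eq : ∃ h : ℝ, HasTopologicalEntropy X h ∧ HasMeasureEntropy μ h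

/-- `X` has more than one measure of maximal entropy. -/
def HasMultipleMME {d : ℕ} {A : Type} [Fintype A] [TopologicalSpace A] [MeasurableSpace A]
    (X : Subshift A (Fin d → ℤ)) : Prop :=
  ∃ μ ν : Measure ((Fin d → ℤ) → A),
    IsMeasureOfMaximalEntropy X μ ∧ IsMeasureOfMaximalEntropy X ν ∧ μ ≠ ν

/-- The set of all real `α` such that some (nonempty) nearest neighbor `ℤ^d` shift of finite type
`X`, over a finite (discrete) alphabet `A`, has more than one measure of maximal entropy and
satisfies `h(X) ≥ log |A| - α`. -/
def alphaSet (d : ℕ) : Set ℝ :=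
  {α | ∃ (A : Type) (_ : Fintype A) (_ : TopologicalSpace A) (_ : DiscreteTopology A)
      (_ : MeasurableSpace A) (_ : BorelSpace A) (F : Fin d → Set (A × A)),
      (nearestNeighborSFT F).carrier.Nonempty ∧
      HasMultipleMME (nearestNeighborSFT F) ∧
      ∃ h : ℝ, HasTopologicalEntropy (nearestNeighborSFT F) h ∧
        h ≥ Real.log (Fintype.card A : ℝ) - α}

/-- `α_d`, the infimum of the above set. -/
def alpha (d : ℕ) : ℝ := sInf (alphaSet d)

/-- The alphabet `{-M, …, -1, 1, …, M}`. -/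
abbrev IcebergAlphabet (M : ℕ) : Type :=
  {a : ℤ // a ∈ (Finset.Icc (-(M : ℤ)) (M : ℤ)).erase 0}

/-- Letters that may be adjacent in the iceberg model: letters of the same sign, and `1` and `-1`
(in either order). -/
def icebergAllowed (a b : ℤ) : Prop :=
  (0 < a ∧ 0 < b) ∨ (a < 0 ∧ b < 0) ∨ (a = 1 ∧ b = -1) ∨ (a = -1 ∧ b = 1)

/-- The iceberg model `I_M`, a nearest neighbor `ℤ^2` shift of finite type. -/
def iceberg (M : ℕ) : Subshift (IcebergAlphabet M) (Fin 2 → ℤ) :=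
  nearestNeighborSFT fun _ => {p | ¬ icebergAllowed p.1 p.2}

end

/-! The iceberg alphabet has `2M` letters, and the positive letters alone already give entropy `log
M = log |A| - log 2`. Any entropy beyond `log M` therefore pushes `alpha 2` below `log 2`, as soon
as two measures of maximal entropy coexist.

Extra entropy: crosses of five sites tile the plane. Each cross may independently carry either five
arbitrary positive letters or a `-1` surrounded by `1`s. The result is always legal, since a
negative letter only touches `1`s. This gives `M^5 + 1` patterns per five sites, hence `h ≥ log (M^5
+ 1) / 5` (`log_add_one_div_five_le_entropy`).

Two measures: a Peierls argument, carried out by counting. Sites next to a sign change carry `±1`.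
With positive boundary, a negative site is enclosed by a king-connected component `D` of the set of
such sites. Flipping the signs inside erases `D` and frees the magnitudes on it, so a given `D` with
given signs occurs with frequency at most `M^(-|D|)` (`card_plusConfigsWithCluster_le`). At most
`162^k` sets `D` of size `k` compete, with `2^k` sign patterns each, so for `M ≥ 5508 = 17 · 324` a
site is negative with frequency at most `1/16` (`card_filter_neg_le`).

The positive boundary costs no entropy, because every legal square pattern can be surrounded by a
layer of `±1` and then by `1`s (`ncard_languageOfShape_le_card_plusConfigs`). Closing up to a torus,
the legal torus configurations with at least three quarters of positive letters have the full growth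
rate. Uniform measures on them are shift-invariant, and by subadditivity of Shannon entropy a weak
limit has maximal entropy (`exists_isMeasureOfMaximalEntropy_of_torus`). It gives probability at
least `3/4` to a positive letter at the origin; reversing the signs yields a different measure. -/

/-! ### Shannon entropy inequalities. -/

section Shannon

/-- Gibbs' inequality against the uniform distribution: the entropy of a probability vector
supported on `S` is at most `log |S|`. -/
theorem sum_negMulLog_le_log_card {β : Type*} [Fintype β] (p : β → ℝ) (hp : ∀ y, 0 ≤ p y)
    (hsum : ∑ y, p y = 1) (S : Finset β) (hS : ∀ y, y ∉ S → p y = 0) :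
    ∑ y, Real.negMulLog (p y) ≤ Real.log S.card := by
  have hsS : ∑ y ∈ S, p y = 1 := by
    rw [← hsum]; exact Finset.sum_subset (Finset.subset_univ _) fun y _ h => hS y h
  have hne : S.Nonempty := by
    by_contra h
    rw [Finset.not_nonempty_iff_eq_empty] at h
    simp [h] at hsS
  have hc : (0 : ℝ) < S.card := by exact_mod_cast hne.card_pos
  have h1 : ∑ y, Real.negMulLog (p y) = ∑ y ∈ S, Real.negMulLog (p y) :=
    (Finset.sum_subset (Finset.subset_univ _) fun y _ h => by simp [hS y h]).symm
  have h2 : ∀ y ∈ S, Real.negMulLog (p y) - p y * Real.log S.card ≤ 1 / S.card - p y := by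
    intro y _
    rcases (hp y).eq_or_lt with h | h
    · rw [← h]; simp
    · have := Real.log_le_sub_one_of_pos (x := 1 / (p y * S.card)) (by positivity)
      rw [Real.log_div one_ne_zero (by positivity), Real.log_mul h.ne' hc.ne', Real.log_one] at this
      have h3 := mul_le_mul_of_nonneg_left this h.le
      have h4 : p y * (1 / (p y * S.card) - 1) = 1 / S.card - p y := by field_simp
      rw [Real.negMulLog]
      linarith
  have h3 := Finset.sum_le_sum h2
  rw [Finset.sum_sub_distrib, Finset.sum_sub_distrib, ← Finset.sum_mul, hsS, Finset.sum_const,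
    nsmul_eq_mul, mul_one_div_cancel hc.ne'] at h3
  rw [h1]; linarith

/-- Subadditivity of Shannon entropy for the uniform distribution on `E`: if the observables `f j`
jointly separate the points of `E`, then `log |E|` is at most the sum of their entropies. -/
theorem log_card_le_sum_entropy {α β ι : Type*} [Fintype β] [Fintype ι] [DecidableEq β]
    (E : Finset α) (hE : E.Nonempty) (f : ι → α → β)
    (hinj : ∀ a ∈ E, ∀ b ∈ E, (∀ j, f j a = f j b) → a = b) :
    Real.log E.card ≤
      ∑ j, ∑ y : β, Real.negMulLog (((E.filter fun a => f j a = y).card : ℝ) / E.card) := by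
  classical
  have hc : (0 : ℝ) < E.card := by exact_mod_cast hE.card_pos
  set c : ι → β → ℝ := fun j y => ((E.filter fun a => f j a = y).card : ℝ) / E.card with hcdef
  have hcpos : ∀ j, ∀ a ∈ E, 0 < c j (f j a) := by
    intro j a ha
    apply div_pos _ hc
    exact_mod_cast Finset.card_pos.2 ⟨a, by simp [ha]⟩
  have hcsum : ∀ j, ∑ y, c j y = 1 := by
    intro j
    rw [hcdef]
    simp only
    rw [← Finset.sum_div, ← Nat.cast_sum,
      ← Finset.card_eq_sum_card_fiberwise (f := f j) (fun a _ => Finset.mem_coe.2 (Finset.mem_univ _))]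
    exact div_self hc.ne'
  -- `q` is the product of the marginals `c j`. Since the observables separate `E`, its total mass
  -- on `E` is at most 1, and Gibbs' inequality for the uniform law against `q` is the claim.
  set q : α → ℝ := fun a => ∏ j, c j (f j a) with hq
  have hqpos : ∀ a ∈ E, 0 < q a := fun a ha => Finset.prod_pos fun j _ => hcpos j a ha
  have hqsum : ∑ a ∈ E, q a ≤ 1 := by
    have h1 : ∏ j : ι, ∑ y : β, c j y = 1 := by simp [hcsum]
    rw [← h1, Finset.prod_univ_sum]
    have h2 : ∑ a ∈ E, q a = ∑ p ∈ E.image (fun a j => f j a), ∏ j, c j (p j) := by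
      rw [Finset.sum_image]
      intro a ha b hb h
      exact hinj a ha b hb fun j => congrFun h j
    rw [h2]
    apply Finset.sum_le_sum_of_subset_of_nonneg
    · intro p _; simp
    · intro p _ _
      exact Finset.prod_nonneg fun j _ => by simp only [hcdef]; positivity
  have h3 : ∑ a ∈ E, Real.log (q a * E.card) ≤ ∑ a ∈ E, (q a * E.card - 1) :=
    Finset.sum_le_sum fun a ha => Real.log_le_sub_one_of_pos (mul_pos (hqpos a ha) hc)
  have h4 : ∑ a ∈ E, (q a * E.card - 1) ≤ 0 := by
    rw [Finset.sum_sub_distrib, ← Finset.sum_mul]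
    simp only [Finset.sum_const, nsmul_eq_mul, mul_one]
    nlinarith
  have h5 : ∑ a ∈ E, Real.log (q a * E.card)
      = ∑ j, ∑ a ∈ E, Real.log (c j (f j a)) + E.card * Real.log E.card := by
    rw [Finset.sum_comm, ← nsmul_eq_mul, ← Finset.sum_const, ← Finset.sum_add_distrib]
    refine Finset.sum_congr rfl fun a ha => ?_
    rw [Real.log_mul (hqpos a ha).ne' hc.ne', hq, Real.log_prod]
    exact fun j _ => (hcpos j a ha).ne'
  have h6 : ∀ j, ∑ y : β, Real.negMulLog (c j y) = -(∑ a ∈ E, Real.log (c j (f j a))) / E.card := by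
    intro j
    rw [← Finset.sum_fiberwise_of_maps_to (s := E) (t := Finset.univ) (g := f j) (by simp),
      ← Finset.sum_neg_distrib, Finset.sum_div]
    refine Finset.sum_congr rfl fun y _ => ?_
    rw [Finset.sum_congr rfl (g := fun _ => Real.log (c j y))
      (fun a ha => by rw [(Finset.mem_filter.1 ha).2]), Finset.sum_const, nsmul_eq_mul,
      Real.negMulLog]
    simp only [hcdef]
    ring
  rw [Finset.sum_congr rfl fun j _ => h6 j, ← Finset.sum_div, Finset.sum_neg_distrib,
    le_div_iff₀ hc]
  linarith

end Shannon

/-! ### Existence of topological entropy by subadditivity. -/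

section TopologicalEntropy

variable {d : ℕ} {A : Type}

theorem mem_box {n : Fin d → ℕ} {p : Fin d → ℤ} : p ∈ box n ↔ ∀ i, 1 ≤ p i ∧ p i ≤ n i := by
  simp [box, Fintype.mem_piFinset]

/-- The translates of `box m` by the vectors `(j_i m_i)_i` cover `box n`. -/
theorem exists_translate_of_mem_box {n m : Fin d → ℕ} (hm : ∀ i, 0 < m i) {p : Fin d → ℤ}
    (hp : p ∈ box n) :
    ∃ j : (i : Fin d) → Fin (n i / m i + 1), ∃ q ∈ box m,
      p = (fun i => ((j i : ℕ) : ℤ) * m i) + q := by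
  rw [mem_box] at hp
  have hm' : ∀ i, (0 : ℤ) < m i := fun i => by exact_mod_cast hm i
  -- Boxes start at 1, so Euclidean division is applied to `p i - 1`.
  refine ⟨fun i => ⟨((p i - 1) / m i).toNat, ?_⟩, fun i => (p i - 1) % m i + 1, ?_, ?_⟩
  · have h1 : (p i - 1) / (m i : ℤ) ≤ (n i : ℤ) / m i :=
      Int.ediv_le_ediv (hm' i) (by have := (hp i).2; omega)
    have h2 : (((n i / m i : ℕ)) : ℤ) = (n i : ℤ) / m i := by simp
    have h3 : (0 : ℤ) ≤ (n i : ℤ) / m i := by positivity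
    omega
  · rw [mem_box]
    intro i
    have h1 := Int.emod_nonneg (p i - 1) (hm' i).ne'
    have h2 := Int.emod_lt_of_pos (p i - 1) (hm' i)
    constructor <;> omega
  · funext i
    have h0 : 0 ≤ (p i - 1) / (m i : ℤ) := Int.ediv_nonneg (by have := (hp i).1; omega) (hm' i).le
    have h3 := Int.mul_ediv_add_emod (p i - 1) (m i)
    simp only [Pi.add_apply, Int.toNat_of_nonneg h0]
    linarith

/-- Extend each pattern to a point of `X` and read it on translates of `box m` covering `box n`.
Translates may stick out of `box n`, which is why the number of boxes can be rounded up. -/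
theorem ncard_languageOfShape_le [Finite A] [TopologicalSpace A] (X : Subshift A (Fin d → ℤ))
    (n m : Fin d → ℕ) (hm : ∀ i, 0 < m i) :
    (languageOfShape X (box n)).ncard
      ≤ (languageOfShape X (box m)).ncard ^ ∏ i, (n i / m i + 1) := by
  have hx : ∀ w : languageOfShape X (box n), ∃ x ∈ X.carrier, (box n).restrict x = w.1 :=
    fun w => w.2
  choose x hxX hxw using hx
  let F : languageOfShape X (box n) →
      (((i : Fin d) → Fin (n i / m i + 1)) → languageOfShape X (box m)) := fun w j =>
    ⟨(box m).restrict (shift (fun i => ((j i : ℕ) : ℤ) * m i) (x w)),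
      Set.mem_image_of_mem _ (X.mapsTo _ (hxX w))⟩
  have hF : Function.Injective F := by
    intro v w h
    apply Subtype.ext
    rw [← hxw v, ← hxw w]
    funext ⟨p, hp⟩
    obtain ⟨j, q, hq, rfl⟩ := exists_translate_of_mem_box hm hp
    have := congrFun (congrArg Subtype.val (congrFun h j)) ⟨q, hq⟩
    simpa [F] using this
  have := Nat.card_le_card_of_injective F hF
  simpa [Nat.card_pi, Nat.card_coe_set_eq, Nat.card_fun] using this

theorem log_ncard_languageOfShape_le [Finite A] [TopologicalSpace A] (X : Subshift A (Fin d → ℤ))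
    (n m : Fin d → ℕ) (hm : ∀ i, 0 < m i) :
    Real.log (languageOfShape X (box n)).ncard
      ≤ (∏ i, ((n i : ℝ) / m i + 1)) * Real.log (languageOfShape X (box m)).ncard := by
  have h0 := Real.log_natCast_nonneg (languageOfShape X (box m)).ncard
  rcases Nat.eq_zero_or_pos (languageOfShape X (box n)).ncard with h | h
  · rw [h]
    simp only [Nat.cast_zero, Real.log_zero]
    positivity
  · have h1 : ((languageOfShape X (box n)).ncard : ℝ)
        ≤ (languageOfShape X (box m)).ncard ^ ∏ i, (n i / m i + 1) := by
      exact_mod_cast ncard_languageOfShape_le X n m hm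
    have h2 := Real.log_le_log (by exact_mod_cast h) h1
    rw [Real.log_pow] at h2
    refine h2.trans (mul_le_mul_of_nonneg_right ?_ h0)
    push_cast
    refine Finset.prod_le_prod (fun i _ => by positivity) fun i _ => ?_
    gcongr
    exact Nat.cast_div_le

theorem tendsto_apply_atTop (i : Fin d) :
    Tendsto (fun n : Fin d → ℕ => (n i : ℝ)) atTop atTop := by
  refine tendsto_natCast_atTop_atTop.comp (tendsto_atTop.2 fun b => ?_)
  filter_upwards [eventually_ge_atTop (fun _ : Fin d => b)] with n hn using hn i

theorem eventually_pos_apply : ∀ᶠ n : Fin d → ℕ in atTop, ∀ i, 0 < n i := by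
  filter_upwards [eventually_ge_atTop (fun _ : Fin d => 1)] with n hn i using hn i

/-- The topological entropy exists, and it is a lower bound of the entropies of all boxes. -/
theorem exists_hasTopologicalEntropy [Finite A] [TopologicalSpace A]
    (X : Subshift A (Fin d → ℤ)) :
    ∃ h, HasTopologicalEntropy X h ∧ ∀ m : Fin d → ℕ, (∀ i, 0 < m i) →
      h ≤ Real.log (languageOfShape X (box m)).ncard / ∏ i, (m i : ℝ) := by
  set a : (Fin d → ℕ) → ℝ :=
    fun m => Real.log (languageOfShape X (box m)).ncard / ∏ i, (m i : ℝ) with ha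
  have ha0 : ∀ m, 0 ≤ a m := fun m =>
    div_nonneg (Real.log_natCast_nonneg _) (Finset.prod_nonneg fun i _ => Nat.cast_nonneg _)
  have hbdd : BddBelow (Set.range fun m : {m : Fin d → ℕ // ∀ i, 0 < m i} => a m) :=
    ⟨0, by rintro _ ⟨m, rfl⟩; exact ha0 _⟩
  have hle : ∀ m : Fin d → ℕ, (∀ i, 0 < m i) →
      (⨅ m : {m : Fin d → ℕ // ∀ i, 0 < m i}, a m) ≤ a m := fun m hm => ciInf_le hbdd ⟨m, hm⟩
  have : Nonempty {m : Fin d → ℕ // ∀ i, 0 < m i} := ⟨⟨fun _ => 1, fun _ => one_pos⟩⟩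
  -- Fekete's argument: the limit is the infimum over boxes. A nearly optimal `m` controls all large
  -- `n`, the rounding errors `1 / n i` being negligible.
  refine ⟨⨅ m : {m : Fin d → ℕ // ∀ i, 0 < m i}, a m, tendsto_order.2 ⟨fun c hc => ?_,
    fun c hc => ?_⟩, hle⟩
  · filter_upwards [eventually_pos_apply] with n hn using hc.trans_le (hle n hn)
  · obtain ⟨⟨m, hm⟩, hmc⟩ := exists_lt_of_ciInf_lt hc
    have hlim : Tendsto (fun n : Fin d → ℕ => (∏ i, (1 / (m i : ℝ) + 1 / (n i : ℝ)))
        * Real.log (languageOfShape X (box m)).ncard) atTop (𝓝 (a m)) := by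
      have h1 : Tendsto (fun n : Fin d → ℕ => ∏ i, (1 / (m i : ℝ) + 1 / (n i : ℝ))) atTop
          (𝓝 (∏ i, (1 / (m i : ℝ) + 0))) := by
        refine tendsto_finsetProd _ fun i _ => tendsto_const_nhds.add ?_
        simpa [Pi.inv_def] using (tendsto_apply_atTop i).inv_tendsto_atTop
      have h2 := h1.mul_const (Real.log (languageOfShape X (box m)).ncard)
      convert h2 using 2
      simp [ha, div_eq_inv_mul]
    filter_upwards [eventually_pos_apply, hlim.eventually_lt_const hmc] with n hn hnc
    refine lt_of_le_of_lt ?_ hnc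
    have hpos : (0 : ℝ) < ∏ i, (n i : ℝ) := Finset.prod_pos fun i _ => by exact_mod_cast hn i
    rw [div_le_iff₀ hpos]
    refine (log_ncard_languageOfShape_le X n m hm).trans (le_of_eq ?_)
    rw [mul_right_comm, ← Finset.prod_mul_distrib]
    congr 1
    refine Finset.prod_congr rfl fun i _ => ?_
    have h1 : (n i : ℝ) ≠ 0 := by exact_mod_cast (hn i).ne'
    field_simp

theorem tendsto_const_atTop_pi : Tendsto (fun (k : ℕ) (_ : Fin d) => k) atTop atTop :=
  tendsto_atTop.2 fun b => by
    filter_upwards [eventually_ge_atTop (∑ i, b i)] with k hk i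
    exact (Finset.single_le_sum (f := b) (fun _ _ => Nat.zero_le _) (Finset.mem_univ i)).trans hk

end TopologicalEntropy

/-! ### Uniform measures on periodic points. -/

section Torus

variable {d : ℕ} {A : Type} {N : ℕ}

/-- The periodic point of the full shift obtained by unrolling a configuration on a torus. -/
def periodicExtension (y : (Fin d → ZMod N) → A) : (Fin d → ℤ) → A :=
  fun t => y fun i => (t i : ZMod N)

theorem shift_periodicExtension (t : Fin d → ℤ) (y : (Fin d → ZMod N) → A) :
    shift t (periodicExtension y) = periodicExtension fun s => y ((fun i => (t i : ZMod N)) + s) := by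
  funext s
  simp only [shift_apply, periodicExtension]
  congr 1
  funext i
  simp

theorem exists_mem_box_cast_eq [NeZero N] (t : Fin d → ZMod N) :
    ∃ p ∈ box (fun _ : Fin d => N), (fun i => ((p i : ℤ) : ZMod N)) = t := by
  refine ⟨fun i => ((t i - 1).val : ℤ) + 1, mem_box.2 fun i => ?_, ?_⟩
  · have := ZMod.val_lt (t i - 1)
    constructor <;> omega
  · funext i
    simp

theorem periodicExtension_mem_nearestNeighborSFT [TopologicalSpace A] [DiscreteTopology A]
    {F : Fin d → Set (A × A)} {y : (Fin d → ZMod N) → A}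
    (hy : ∀ i t, (y t, y (t + Pi.single i 1)) ∉ F i) :
    periodicExtension y ∈ (nearestNeighborSFT F).carrier := by
  intro i t
  have e : (fun l => (((t + Pi.single i 1 : Fin d → ℤ) l : ℤ) : ZMod N))
      = (fun l => (t l : ZMod N)) + Pi.single i 1 := by
    funext l
    rcases eq_or_ne l i with rfl | h
    · simp
    · simp [h]
  have := hy i fun l => (t l : ZMod N)
  rw [← e] at this
  exact this

/-- A nonempty family of torus configurations closed under the translations of the torus. -/
structure IsTorusEnsemble (E : Finset ((Fin d → ZMod N) → A)) : Prop where
  nonempty : E.Nonempty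
  translate_mem : ∀ t, ∀ y ∈ E, (fun s => y (t + s)) ∈ E

open scoped Classical in
theorem IsTorusEnsemble.card_filter_translate {E : Finset ((Fin d → ZMod N) → A)}
    (hE : IsTorusEnsemble E) (t : Fin d → ZMod N) (Q : ((Fin d → ZMod N) → A) → Prop) :
    (E.filter fun y => Q fun s => y (t + s)).card = (E.filter Q).card := by
  refine Finset.card_bij' (fun y _ s => y (t + s)) (fun y _ s => y (-t + s)) ?_ ?_ ?_ ?_
  · intro y hy
    rw [Finset.mem_filter] at hy ⊢
    exact ⟨hE.translate_mem t y hy.1, hy.2⟩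
  · intro y hy
    rw [Finset.mem_filter] at hy ⊢
    refine ⟨hE.translate_mem (-t) y hy.1, ?_⟩
    simpa using hy.2
  · intro y _; simp
  · intro y _; simp

variable [MeasurableSpace A]

/-- The uniform distribution on the periodic points coming from `E`. -/
noncomputable def torusMeasure (E : Finset ((Fin d → ZMod N) → A)) : Measure ((Fin d → ℤ) → A) :=
  (E.card : ENNReal)⁻¹ • ∑ y ∈ E, Measure.dirac (periodicExtension y)

open scoped Classical in
theorem torusMeasure_apply (E : Finset ((Fin d → ZMod N) → A)) {S : Set ((Fin d → ℤ) → A)}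
    (hS : MeasurableSet S) :
    torusMeasure E S = (E.filter fun y => periodicExtension y ∈ S).card / E.card := by
  simp only [torusMeasure, Measure.smul_apply, Measure.finsetSum_apply, smul_eq_mul,
    Measure.dirac_apply' _ hS, Set.indicator_apply, Pi.one_apply, Finset.sum_boole]
  rw [mul_comm, ENNReal.div_eq_inv_mul, mul_comm]

theorem torusMeasure_eq_zero {E : Finset ((Fin d → ZMod N) → A)} {S : Set ((Fin d → ℤ) → A)}
    (hS : MeasurableSet S) (h : ∀ y ∈ E, periodicExtension y ∉ S) : torusMeasure E S = 0 := by
  classical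
  rw [torusMeasure_apply E hS, Finset.filter_false_of_mem h]
  simp

open scoped Classical in
theorem torusMeasure_real (E : Finset ((Fin d → ZMod N) → A)) {S : Set ((Fin d → ℤ) → A)}
    (hS : MeasurableSet S) :
    (torusMeasure E).real S = ((E.filter fun y => periodicExtension y ∈ S).card : ℝ) / E.card := by
  simp [measureReal_def, torusMeasure_apply E hS]

theorem isProbabilityMeasure_torusMeasure {E : Finset ((Fin d → ZMod N) → A)} (hE : E.Nonempty) :
    IsProbabilityMeasure (torusMeasure E) := by
  classical
  refine ⟨?_⟩
  rw [torusMeasure_apply E MeasurableSet.univ]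
  simp only [Set.mem_univ, Finset.filter_true]
  exact ENNReal.div_self (by simpa using hE.ne_empty) (by simp)

theorem measurable_shift (t : Fin d → ℤ) :
    Measurable (shift t : ((Fin d → ℤ) → A) → ((Fin d → ℤ) → A)) :=
  measurable_pi_lambda _ fun _ => measurable_pi_apply _

theorem IsTorusEnsemble.measurePreserving_shift {E : Finset ((Fin d → ZMod N) → A)}
    (hE : IsTorusEnsemble E) (t : Fin d → ℤ) :
    MeasurePreserving (shift t) (torusMeasure E) (torusMeasure E) := by
  classical
  refine ⟨measurable_shift t, ?_⟩
  ext S hS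
  rw [Measure.map_apply (measurable_shift t) hS, torusMeasure_apply E hS,
    torusMeasure_apply E (measurable_shift t hS)]
  simp only [Set.mem_preimage, shift_periodicExtension]
  rw [hE.card_filter_translate (fun i => (t i : ZMod N)) fun y => periodicExtension y ∈ S]

theorem measurableSet_restrict_eq [MeasurableSingletonClass A] (S : Finset (Fin d → ℤ))
    (w : S → A) : MeasurableSet {x : (Fin d → ℤ) → A | S.restrict x = w} := by
  have : {x : (Fin d → ℤ) → A | S.restrict x = w} = ⋂ p : S, (fun x => x p.1) ⁻¹' {w p} := by
    ext x
    simp [funext_iff]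
  rw [this]
  exact MeasurableSet.iInter fun p => measurable_pi_apply _ (measurableSet_singleton _)

variable [Fintype A] [MeasurableSingletonClass A]

/-- The entropy of the distribution of the restriction to `box m`. -/
noncomputable def boxEntropy (μ : Measure ((Fin d → ℤ) → A)) (m : Fin d → ℕ) : ℝ :=
  ∑ w : box m → A, Real.negMulLog (μ.real {x | (box m).restrict x = w})

/-- Translates of `box m` cover a fundamental domain, so their patterns determine the torus
configuration. Subadditivity applies, and shift invariance makes all the summands equal. -/
theorem IsTorusEnsemble.log_card_le [NeZero N] {E : Finset ((Fin d → ZMod N) → A)}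
    (hE : IsTorusEnsemble E) (m : Fin d → ℕ) (hm : ∀ i, 0 < m i) :
    Real.log E.card ≤ (∏ i, ((N : ℝ) / m i + 1)) * boxEntropy (torusMeasure E) m := by
  classical
  have hP := isProbabilityMeasure_torusMeasure hE.nonempty
  have key := log_card_le_sum_entropy (ι := (i : Fin d) → Fin (N / m i + 1)) E hE.nonempty
    (fun j y => (box m).restrict
      (shift (fun i => ((j i : ℕ) : ℤ) * m i) (periodicExtension y))) (by
      intro y _ z _ h
      funext t
      obtain ⟨p, hp, rfl⟩ := exists_mem_box_cast_eq t
      obtain ⟨j, q, hq, rfl⟩ := exists_translate_of_mem_box hm hp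
      have := congrFun (h j) ⟨q, hq⟩
      simpa [periodicExtension] using this)
  have hj : ∀ j : (i : Fin d) → Fin (N / m i + 1),
      (∑ w : box m → A, Real.negMulLog (((E.filter fun y => (box m).restrict
        (shift (fun i => ((j i : ℕ) : ℤ) * m i) (periodicExtension y)) = w).card : ℝ) / E.card))
      = boxEntropy (torusMeasure E) m := by
    intro j
    refine Finset.sum_congr rfl fun w _ => ?_
    have hS := measurableSet_restrict_eq (box m) w
    have h1 := (hE.measurePreserving_shift fun i => ((j i : ℕ) : ℤ) * m i).measureReal_preimage
      hS.nullMeasurableSet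
    rw [torusMeasure_real E (measurable_shift _ hS)] at h1
    rw [← h1]
    simp only [Set.mem_preimage]
    congr!
  rw [Finset.sum_congr rfl fun j _ => hj j, Finset.sum_const, nsmul_eq_mul] at key
  refine key.trans (mul_le_mul_of_nonneg_right ?_ ?_)
  · simp only [Finset.card_univ, Fintype.card_pi, Fintype.card_fin]
    push_cast
    refine Finset.prod_le_prod (fun i _ => by positivity) fun i _ => ?_
    gcongr
    exact Nat.cast_div_le
  · exact Finset.sum_nonneg fun w _ => Real.negMulLog_nonneg measureReal_nonneg measureReal_le_one

-- Double counting of pairs (configuration, site): by translation invariance every site contributes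
-- the same number of configurations.
open scoped Classical in
theorem IsTorusEnsemble.le_torusMeasure_real [NeZero N] {E : Finset ((Fin d → ZMod N) → A)}
    (hE : IsTorusEnsemble E) (P : Set A) (c : ℝ)
    (hc : ∀ y ∈ E, c * (N : ℝ) ^ d ≤ (Finset.univ.filter fun t => y t ∈ P).card) :
    c ≤ (torusMeasure E).real {x | x 0 ∈ P} := by
  have hS : MeasurableSet {x : (Fin d → ℤ) → A | x 0 ∈ P} :=
    measurable_pi_apply (0 : Fin d → ℤ) P.toFinite.measurableSet
  have hEc : (0 : ℝ) < E.card := by exact_mod_cast hE.nonempty.card_pos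
  have hN : (0 : ℝ) < (N : ℝ) ^ d := by
    have : (0 : ℝ) < N := by exact_mod_cast Nat.pos_of_ne_zero (NeZero.ne N)
    positivity
  rw [torusMeasure_real E hS, le_div_iff₀ hEc]
  have h1 : ∀ t : Fin d → ZMod N,
      (E.filter fun y => y t ∈ P).card = (E.filter fun y => y 0 ∈ P).card := by
    intro t
    have := hE.card_filter_translate t fun y => y 0 ∈ P
    simpa using this
  have h2 : ∑ t : Fin d → ZMod N, (E.filter fun y => y t ∈ P).card
      = ∑ y ∈ E, (Finset.univ.filter fun t => y t ∈ P).card := by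
    simp only [Finset.card_filter]
    exact Finset.sum_comm
  rw [Finset.sum_congr rfl fun t _ => h1 t, Finset.sum_const, smul_eq_mul, Finset.card_univ,
    Fintype.card_fun, ZMod.card, Fintype.card_fin] at h2
  have h3 := Finset.sum_le_sum hc
  rw [Finset.sum_const, nsmul_eq_mul, ← Nat.cast_sum, ← h2] at h3
  push_cast at h3
  have h4 : {y ∈ E | periodicExtension y ∈ {x : (Fin d → ℤ) → A | x 0 ∈ P}}
      = E.filter fun y => y 0 ∈ P := by
    refine Finset.filter_congr fun y _ => ?_
    have : (fun i : Fin d => (((0 : Fin d → ℤ) i : ℤ) : ZMod N)) = 0 := by funext i; simp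
    change y _ ∈ P ↔ _
    rw [this]
  rw [h4]
  refine le_of_mul_le_mul_left ?_ hN
  linarith

theorem boxEntropy_le_log_ncard [TopologicalSpace A]
    (X : Subshift A (Fin d → ℤ)) (μ : Measure ((Fin d → ℤ) → A)) [IsProbabilityMeasure μ]
    (hX : μ X.carrierᶜ = 0) (m : Fin d → ℕ) :
    boxEntropy μ m ≤ Real.log (languageOfShape X (box m)).ncard := by
  classical
  rw [Set.ncard_eq_toFinset_card' (languageOfShape X (box m))]
  refine sum_negMulLog_le_log_card _ (fun _ => measureReal_nonneg) ?_ _ fun w hw => ?_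
  · have := sum_measureReal_preimage_singleton (μ := μ) (f := (box m).restrict (π := fun _ => A))
      (Finset.univ : Finset (box m → A)) (fun w _ => measurableSet_restrict_eq (box m) w)
    simpa [Set.preimage] using this
  · rw [measureReal_def]
    have hsub : {x | (box m).restrict x = w} ⊆ X.carrierᶜ := by
      intro x hx hxX
      exact hw (Set.mem_toFinset.2 ⟨x, hxX, hx⟩)
    have : μ {x | (box m).restrict x = w} = 0 := measure_mono_null hsub hX
    simp [this]

end Torus

/-! ### Weak limits of torus measures. -/

section Limit

theorem isClopen_restrict_eq {d : ℕ} {A : Type} [TopologicalSpace A] [DiscreteTopology A]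
    (S : Finset (Fin d → ℤ)) (w : S → A) :
    IsClopen {x : (Fin d → ℤ) → A | S.restrict x = w} :=
  (isClopen_discrete {w}).preimage (by fun_prop : Continuous (S.restrict (π := fun _ => A)))

variable {d : ℕ} {A : Type} [Fintype A] [TopologicalSpace A] [DiscreteTopology A]
  [MeasurableSpace A] [BorelSpace A]

theorem tendsto_real_of_isClopen {ι : Type*} {l : Filter ι}
    {ν : ι → ProbabilityMeasure ((Fin d → ℤ) → A)} {μ : ProbabilityMeasure ((Fin d → ℤ) → A)}
    (h : Tendsto ν l (𝓝 μ)) {S : Set ((Fin d → ℤ) → A)} (hS : IsClopen S) :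
    Tendsto (fun k => (ν k : Measure _).real S) l (𝓝 ((μ : Measure _).real S)) := by
  have h0 : (μ : Measure _) (frontier S) = 0 := by simp [hS.frontier_eq]
  have := ProbabilityMeasure.tendsto_measure_of_null_frontier_of_tendsto' h h0
  exact (ENNReal.tendsto_toReal (measure_ne_top _ _)).comp this

/-- Torus ensembles whose exponential growth rate is the topological entropy have a limit point
which is a measure of maximal entropy, and which inherits lower bounds on the density of a set of
letters. -/
theorem exists_isMeasureOfMaximalEntropy_of_torus (F : Fin d → Set (A × A)) {h : ℝ}
    (hh : HasTopologicalEntropy (nearestNeighborSFT F) h) (N : ℕ → ℕ) [∀ k, NeZero (N k)]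
    (hN : Tendsto N atTop atTop) (E : ∀ k, Finset ((Fin d → ZMod (N k)) → A))
    (hE : ∀ k, IsTorusEnsemble (E k))
    (hlegal : ∀ k, ∀ y ∈ E k, ∀ i t, (y t, y (t + Pi.single i 1)) ∉ F i)
    (g : ℕ → ℝ) (hg : Tendsto g atTop (𝓝 h))
    (hcard : ∀ k, g k * (N k : ℝ) ^ d ≤ Real.log (E k).card) (P : Set A) (c : ℝ)
    (hP : ∀ k, ∀ y ∈ E k, c * (N k : ℝ) ^ d ≤ {t | y t ∈ P}.ncard) :
    ∃ μ : Measure ((Fin d → ℤ) → A), IsMeasureOfMaximalEntropy (nearestNeighborSFT F) μ ∧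
      c ≤ μ.real {x | x 0 ∈ P} := by
  classical
  set X := nearestNeighborSFT F with hX
  let ν : ℕ → ProbabilityMeasure ((Fin d → ℤ) → A) := fun k =>
    ⟨torusMeasure (E k), isProbabilityMeasure_torusMeasure (hE k).nonempty⟩
  -- A limit along an ultrafilter, given by compactness of the space of probability measures,
  -- replaces extraction of a subsequence.
  let l : Ultrafilter ℕ := hyperfilter ℕ
  have hl : (l : Filter ℕ) ≤ atTop := Nat.hyperfilter_le_atTop
  obtain ⟨μ, hμ⟩ : ∃ μ, Tendsto ν l (𝓝 μ) := by
    obtain ⟨μ, _, hμ⟩ := isCompact_univ.ultrafilter_le_nhds (l.map ν) (by simp)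
    exact ⟨μ, hμ⟩
  have hinv : ∀ t : Fin d → ℤ, MeasurePreserving (shift t) (μ : Measure ((Fin d → ℤ) → A)) μ := by
    intro t
    have hcont : Continuous (shift t : ((Fin d → ℤ) → A) → ((Fin d → ℤ) → A)) :=
      continuous_shift t
    have h1 := ProbabilityMeasure.tendsto_map_of_tendsto_of_continuous ν μ hμ hcont
    have h2 : (fun k => (ν k).map hcont.measurable.aemeasurable) = ν := by
      funext k
      apply Subtype.ext
      exact ((hE k).measurePreserving_shift t).map_eq
    rw [h2] at h1
    have h3 := tendsto_nhds_unique h1 hμ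
    refine ⟨hcont.measurable, ?_⟩
    exact congrArg ProbabilityMeasure.toMeasure h3
  have hXc : (μ : Measure ((Fin d → ℤ) → A)) X.carrierᶜ = 0 := by
    have h1 : ∀ k, (ν k : Measure ((Fin d → ℤ) → A)) X.carrierᶜ = 0 := by
      intro k
      change torusMeasure (E k) X.carrierᶜ = 0
      exact torusMeasure_eq_zero X.isClosed.measurableSet.compl fun y hy hy' =>
        hy' (periodicExtension_mem_nearestNeighborSFT (hlegal k y hy))
    -- The complement of `X` is open and null for every `ν k`, so the portmanteau inequality makes
    -- it null for `μ`.
    have h2 := ProbabilityMeasure.le_liminf_measure_open_of_tendsto hμ X.isClosed.isOpen_compl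
    simpa [h1] using h2
  have hH : ∀ m, Tendsto (fun k => boxEntropy (ν k : Measure ((Fin d → ℤ) → A)) m) l
      (𝓝 (boxEntropy (μ : Measure ((Fin d → ℤ) → A)) m)) := by
    intro m
    refine tendsto_finsetSum _ fun w _ => ?_
    exact (Real.continuous_negMulLog.tendsto _).comp
      (tendsto_real_of_isClopen hμ (isClopen_restrict_eq _ w))
  -- Subadditivity transfers the growth rate of `E k` to each fixed box `m`; cylinders are clopen,
  -- so box entropies pass to the limit while the rounding terms `1 / N k` disappear.
  have hlow : ∀ m : Fin d → ℕ, (∀ i, 0 < m i) →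
      h ≤ boxEntropy (μ : Measure ((Fin d → ℤ) → A)) m / ∏ i, (m i : ℝ) := by
    intro m hm
    have h1 : Tendsto (fun k => ∏ i, (1 / (m i : ℝ) + 1 / (N k : ℝ))) l
        (𝓝 (∏ i, (1 / (m i : ℝ) + 0))) := by
      refine tendsto_finsetProd _ fun i _ => tendsto_const_nhds.add ?_
      have h2 := (tendsto_natCast_atTop_atTop (R := ℝ)).comp hN
      simpa [Pi.inv_def] using h2.inv_tendsto_atTop.mono_left hl
    have h2 := h1.mul (hH m)
    have h3 : (∏ i, (1 / (m i : ℝ) + 0)) * boxEntropy (μ : Measure ((Fin d → ℤ) → A)) m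
        = boxEntropy (μ : Measure ((Fin d → ℤ) → A)) m / ∏ i, (m i : ℝ) := by
      simp [div_eq_inv_mul]
    rw [h3] at h2
    refine le_of_tendsto_of_tendsto' (hg.mono_left hl) h2 fun k => ?_
    have hNk : (0 : ℝ) < N k := by exact_mod_cast Nat.pos_of_ne_zero (NeZero.ne (N k))
    have h4 := (hcard k).trans ((hE k).log_card_le m hm)
    have h5 : (∏ i, ((N k : ℝ) / m i + 1)) = (∏ i, (1 / (m i : ℝ) + 1 / (N k : ℝ))) * N k ^ d := by
      rw [show (N k : ℝ) ^ d = ∏ _i : Fin d, (N k : ℝ) by simp, ← Finset.prod_mul_distrib]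
      refine Finset.prod_congr rfl fun i _ => ?_
      have : (m i : ℝ) ≠ 0 := by exact_mod_cast (hm i).ne'
      field_simp
    rw [h5, mul_right_comm] at h4
    exact le_of_mul_le_mul_right h4 (by positivity)
  refine ⟨μ, ⟨inferInstance, hinv, ?_, h, hh, ?_⟩, ?_⟩
  · exact Measure.support_subset_of_isClosed X.isClosed (mem_ae_iff.2 hXc)
  -- Squeeze the normalized box entropy between `h` and the normalized logarithm of the number of
  -- patterns.
  · refine tendsto_of_tendsto_of_tendsto_of_le_of_le' tendsto_const_nhds hh ?_ ?_
    · filter_upwards [eventually_pos_apply] with m hm using hlow m hm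
    · refine Eventually.of_forall fun m => ?_
      refine div_le_div_of_nonneg_right (boxEntropy_le_log_ncard X _ hXc m) ?_
      exact Finset.prod_nonneg fun i _ => Nat.cast_nonneg _
  · have hS : IsClopen {x : (Fin d → ℤ) → A | x 0 ∈ P} :=
      (isClopen_discrete P).preimage (continuous_apply (0 : Fin d → ℤ))
    refine ge_of_tendsto' (tendsto_real_of_isClopen hμ hS) fun k => ?_
    refine (hE k).le_torusMeasure_real P c fun y hy => (hP k y hy).trans (le_of_eq ?_)
    rw [Set.ncard_eq_toFinset_card']
    congr 2
    ext t
    simp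

end Limit

/-! ### Counting king-connected sets by walks. -/

section KingWalks

/-- Two sites of the square lattice at distance at most one in the maximum norm. -/
def KingAdj (p q : ℤ × ℤ) : Prop :=
  (p.1 ≤ q.1 + 1 ∧ q.1 ≤ p.1 + 1) ∧ (p.2 ≤ q.2 + 1 ∧ q.2 ≤ p.2 + 1)

theorem KingAdj.symm {p q : ℤ × ℤ} (h : KingAdj p q) : KingAdj q p :=
  ⟨h.1.symm, h.2.symm⟩

/-- The nine displacements of maximum norm at most one. -/
noncomputable def kingSteps : Finset (ℤ × ℤ) := Finset.Icc (-1) 1 ×ˢ Finset.Icc (-1) 1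

theorem mem_kingSteps {a : ℤ × ℤ} :
    a ∈ kingSteps ↔ (-1 ≤ a.1 ∧ a.1 ≤ 1) ∧ (-1 ≤ a.2 ∧ a.2 ≤ 1) := by
  simp only [kingSteps, Finset.mem_product, Finset.mem_Icc]

theorem card_kingSteps : kingSteps.card = 9 := by simp [kingSteps]

/-- The set of sites visited by the walk with starting point `p` and steps `w`. -/
def visit : ℤ × ℤ → List (ℤ × ℤ) → Finset (ℤ × ℤ)
  | p, [] => {p}
  | p, a :: w => insert p (visit (p + a) w)

theorem mem_visit_self (p : ℤ × ℤ) (w : List (ℤ × ℤ)) : p ∈ visit p w := by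
  cases w <;> simp [visit]

/-- A detour from a visited site to a neighbor and back. -/
theorem exists_visit_eq_insert (a : ℤ × ℤ) (w : List (ℤ × ℤ)) (p q : ℤ × ℤ) (hq : q ∈ visit p w) :
    ∃ w' : List (ℤ × ℤ), w'.length = w.length + 2 ∧ visit p w' = insert (q + a) (visit p w) ∧
      ∀ b ∈ w', b ∈ w ∨ b = a ∨ b = -a := by
  have base : ∀ (p : ℤ × ℤ) (w : List (ℤ × ℤ)), ∃ w' : List (ℤ × ℤ), w'.length = w.length + 2 ∧
      visit p w' = insert (p + a) (visit p w) ∧ ∀ b ∈ w', b ∈ w ∨ b = a ∨ b = -a := by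
    intro p w
    refine ⟨a :: -a :: w, by simp, ?_, ?_⟩
    · simp only [visit, add_neg_cancel_right]
      rw [Finset.insert_comm, Finset.insert_eq_of_mem (mem_visit_self p w)]
    · intro b hb
      simp only [List.mem_cons] at hb
      tauto
  induction w generalizing p with
  | nil =>
    obtain rfl : q = p := by simpa [visit] using hq
    exact base q []
  | cons c w ih =>
    rcases Finset.mem_insert.1 hq with rfl | hq
    · exact base q (c :: w)
    · obtain ⟨w', h1, h2, h3⟩ := ih (p + c) hq
      refine ⟨c :: w', by simp [h1], ?_, ?_⟩
      · simp only [visit, h2]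
        rw [Finset.insert_comm]
      · intro b hb
        simp only [List.mem_cons] at hb ⊢
        rcases hb with rfl | hb
        · simp
        · have := h3 b hb
          tauto

theorem fst_le_of_mem_visit {w : List (ℤ × ℤ)} (hw : ∀ a ∈ w, a ∈ kingSteps) {p q : ℤ × ℤ}
    (hq : q ∈ visit p w) : q.1 ≤ p.1 + w.length := by
  induction w generalizing p with
  | nil =>
    obtain rfl : q = p := by simpa [visit] using hq
    simp
  | cons c w ih =>
    rcases Finset.mem_insert.1 hq with rfl | hq
    · have : (0 : ℤ) ≤ ((c :: w).length : ℤ) := by positivity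
      omega
    · have h1 := ih (fun a ha => hw a (List.mem_cons_of_mem _ ha)) hq
      have h2 := mem_kingSteps.1 (hw c List.mem_cons_self)
      simp only [Prod.fst_add, List.length_cons] at h1 ⊢
      push_cast
      omega

/-- A finite king-connected set is the set of sites visited by a walk whose length is twice the
number of its sites minus two. -/
theorem exists_visit_eq (D : Finset (ℤ × ℤ)) (p : ℤ × ℤ) (hp : p ∈ D)
    (hconn : ∀ S ⊆ D, p ∈ S → (∀ q ∈ S, ∀ r ∈ D, KingAdj q r → r ∈ S) → S = D) :
    ∃ w : List (ℤ × ℤ), (∀ a ∈ w, a ∈ kingSteps) ∧ w.length = 2 * (D.card - 1) ∧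
      visit p w = D := by
  have key : ∀ n, n + 1 ≤ D.card → ∃ w : List (ℤ × ℤ), (∀ a ∈ w, a ∈ kingSteps) ∧
      w.length = 2 * n ∧ visit p w ⊆ D ∧ (visit p w).card = n + 1 := by
    intro n
    induction n with
    | zero => exact fun _ => ⟨[], by simp, by simp, by simpa [visit] using hp, by simp [visit]⟩
    | succ n ih =>
      intro hn
      obtain ⟨w, h1, h2, h3, h4⟩ := ih (by omega)
      have hne : visit p w ≠ D := by
        intro h
        rw [h] at h4
        omega
      obtain ⟨q, hq, r, hr, hqr, hrw⟩ : ∃ q ∈ visit p w, ∃ r ∈ D, KingAdj q r ∧ r ∉ visit p w := by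
        by_contra! h
        exact hne (hconn _ h3 (mem_visit_self p w) h)
      -- Each new site costs a detour of two steps.
      obtain ⟨w', h5, h6, h7⟩ := exists_visit_eq_insert (r - q) w p q hq
      rw [add_sub_cancel] at h6
      refine ⟨w', ?_, by omega, ?_, ?_⟩
      · intro b hb
        rcases h7 b hb with h | rfl | rfl
        · exact h1 b h
        · obtain ⟨⟨_, _⟩, _, _⟩ := hqr
          rw [mem_kingSteps]
          simp only [Prod.fst_sub, Prod.snd_sub]
          omega
        · obtain ⟨⟨_, _⟩, _, _⟩ := hqr
          rw [mem_kingSteps]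
          simp only [Prod.fst_sub, Prod.snd_sub, Prod.fst_neg, Prod.snd_neg]
          omega
      · rw [h6]
        exact Finset.insert_subset hr h3
      · rw [h6, Finset.card_insert_of_notMem hrw, h4]
  have hpos : 0 < D.card := Finset.card_pos.2 ⟨p, hp⟩
  obtain ⟨w, h1, h2, h3, h4⟩ := key (D.card - 1) (by omega)
  exact ⟨w, h1, h2, Finset.eq_of_subset_of_card_le h3 (by omega)⟩

/-- The sets visited by king walks of length `2 (k - 1)` that start in the row of `t`, to the left
of `t` and at distance less than `2 k`. -/
noncomputable def kingClusters (t : ℤ × ℤ) (k : ℕ) : Finset (Finset (ℤ × ℤ)) :=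
  (Finset.range (2 * k) ×ˢ Fintype.piFinset fun _ : Fin (2 * (k - 1)) => kingSteps).image
    fun jw => visit (t.1 - jw.1, t.2) (List.ofFn jw.2)

/-- `162 = 2 · 81`: there are `2k ≤ 2^k` starting points and `9^(2(k-1)) ≤ 81^k` walks. -/
theorem card_kingClusters_le (t : ℤ × ℤ) {k : ℕ} (hk : 1 ≤ k) :
    (kingClusters t k).card ≤ 162 ^ k := by
  refine Finset.card_image_le.trans ?_
  rw [Finset.card_product, Finset.card_range, Fintype.card_piFinset]
  simp only [card_kingSteps, Finset.prod_const, Finset.card_univ, Fintype.card_fin]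
  have h1 : 2 * k ≤ 2 ^ k := by
    obtain ⟨j, rfl⟩ : ∃ j, k = j + 1 := ⟨k - 1, by omega⟩
    have : j < 2 ^ j := Nat.lt_two_pow_self
    rw [pow_succ]
    omega
  have h2 : 9 ^ (2 * (k - 1)) ≤ 81 ^ k := by
    rw [pow_mul]
    exact Nat.pow_le_pow_right (by norm_num) (by omega)
  calc 2 * k * 9 ^ (2 * (k - 1)) ≤ 2 ^ k * 81 ^ k := Nat.mul_le_mul h1 h2
    _ = 162 ^ k := by rw [← mul_pow]; norm_num

theorem visit_mem_kingClusters {t : ℤ × ℤ} {k j : ℕ} (hj : j < 2 * k) {w : List (ℤ × ℤ)}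
    (hw : ∀ a ∈ w, a ∈ kingSteps) (hlen : w.length = 2 * (k - 1)) :
    visit (t.1 - j, t.2) w ∈ kingClusters t k := by
  rw [kingClusters, Finset.mem_image]
  rw [← hlen]
  refine ⟨(j, fun i => w.get i), ?_, by simp⟩
  rw [Finset.mem_product]
  exact ⟨Finset.mem_range.2 hj, Fintype.mem_piFinset.2 fun i => hw _ (List.get_mem _ _)⟩

end KingWalks

/-! ### Contours of a sign field and their interiors. -/

section Contours

/-- The sites having a nearest neighbor of the opposite sign. -/
def signBoundary (s : ℤ × ℤ → ZMod 2) : Set (ℤ × ℤ) :=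
  {p | s p ≠ s (p.1 + 1, p.2) ∨ s p ≠ s (p.1 - 1, p.2) ∨ s p ≠ s (p.1, p.2 + 1) ∨
    s p ≠ s (p.1, p.2 - 1)}

/-- `D` is a union of king-connected components of the sign boundary. -/
structure IsBoundaryCluster (s : ℤ × ℤ → ZMod 2) (D : Finset (ℤ × ℤ)) : Prop where
  subset : ∀ p ∈ D, p ∈ signBoundary s
  closed : ∀ p ∈ D, ∀ q ∈ signBoundary s, KingAdj p q → q ∈ D

/-- The sign change across the horizontal edge starting at `p`, if this edge lies in `D`. -/
def horizontalJump (D : Finset (ℤ × ℤ)) (s : ℤ × ℤ → ZMod 2) (p : ℤ × ℤ) : ZMod 2 :=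
  if p ∈ D ∧ (p.1 + 1, p.2) ∈ D then s p + s (p.1 + 1, p.2) else 0

/-- The sign change across the vertical edge starting at `p`, if this edge lies in `D`. -/
def verticalJump (D : Finset (ℤ × ℤ)) (s : ℤ × ℤ → ZMod 2) (p : ℤ × ℤ) : ZMod 2 :=
  if p ∈ D ∧ (p.1, p.2 + 1) ∈ D then s p + s (p.1, p.2 + 1) else 0

/-- The sign function whose jumps are those of `s` inside `D`. -/
noncomputable def interiorIndicator (D : Finset (ℤ × ℤ)) (s : ℤ × ℤ → ZMod 2) (p : ℤ × ℤ) : ZMod 2 :=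
  ∑ l ∈ Finset.Ico (-2) p.1, horizontalJump D s (l, p.2)

/-- This makes the flip reversible: the signs on `D` alone determine which sites are flipped. -/
theorem interiorIndicator_congr {D : Finset (ℤ × ℤ)} {s s' : ℤ × ℤ → ZMod 2}
    (h : ∀ p ∈ D, s p = s' p) : interiorIndicator D s = interiorIndicator D s' := by
  funext p
  refine Finset.sum_congr rfl fun l _ => ?_
  unfold horizontalJump
  split_ifs with hl
  · rw [h _ hl.1, h _ hl.2]
  · rfl

theorem ZMod.two_add_eq_zero_of_eq {a b : ZMod 2} (h : a = b) : a + b = 0 := by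
  subst h; exact CharTwo.add_self_eq_zero a

variable {s : ℤ × ℤ → ZMod 2} {D : Finset (ℤ × ℤ)}

theorem fst_succ_mem_signBoundary {p : ℤ × ℤ} (h : s p ≠ s (p.1 + 1, p.2)) :
    p ∈ signBoundary s ∧ (p.1 + 1, p.2) ∈ signBoundary s := by
  refine ⟨Or.inl h, Or.inr (Or.inl ?_)⟩
  simpa using h.symm

theorem snd_succ_mem_signBoundary {p : ℤ × ℤ} (h : s p ≠ s (p.1, p.2 + 1)) :
    p ∈ signBoundary s ∧ (p.1, p.2 + 1) ∈ signBoundary s := by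
  refine ⟨Or.inr (Or.inr (Or.inl h)), Or.inr (Or.inr (Or.inr ?_))⟩
  simpa using h.symm

/-- Without a sign change both sides vanish; with one, both endpoints lie in the sign boundary next
to `q`, and closedness puts them in `D`. -/
theorem IsBoundaryCluster.horizontalJump_eq (hD : IsBoundaryCluster s D) {p q : ℤ × ℤ}
    (hq : q ∈ D) (h1 : KingAdj q p) (h2 : KingAdj q (p.1 + 1, p.2)) :
    horizontalJump D s p = s p + s (p.1 + 1, p.2) := by
  by_cases h : s p = s (p.1 + 1, p.2)
  · unfold horizontalJump
    rw [ZMod.two_add_eq_zero_of_eq h, ite_self]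
  · obtain ⟨h3, h4⟩ := fst_succ_mem_signBoundary h
    exact if_pos ⟨hD.closed q hq _ h3 h1, hD.closed q hq _ h4 h2⟩

theorem IsBoundaryCluster.verticalJump_eq (hD : IsBoundaryCluster s D) {p q : ℤ × ℤ}
    (hq : q ∈ D) (h1 : KingAdj q p) (h2 : KingAdj q (p.1, p.2 + 1)) :
    verticalJump D s p = s p + s (p.1, p.2 + 1) := by
  by_cases h : s p = s (p.1, p.2 + 1)
  · unfold verticalJump
    rw [ZMod.two_add_eq_zero_of_eq h, ite_self]
  · obtain ⟨h3, h4⟩ := snd_succ_mem_signBoundary h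
    exact if_pos ⟨hD.closed q hq _ h3 h1, hD.closed q hq _ h4 h2⟩

/-- The jumps around a plaquette cancel. -/
theorem IsBoundaryCluster.plaquette (hD : IsBoundaryCluster s D) (i j : ℤ) :
    horizontalJump D s (i, j) + verticalJump D s (i + 1, j)
      = verticalJump D s (i, j) + horizontalJump D s (i, j + 1) := by
  -- If `D` meets the plaquette, all corners are king-adjacent to a point of `D`, so the four jumps
  -- are true sign changes and cancel. Otherwise all four vanish.
  by_cases h : ∃ q ∈ D, (i ≤ q.1 ∧ q.1 ≤ i + 1) ∧ (j ≤ q.2 ∧ q.2 ≤ j + 1)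
  · obtain ⟨q, hq, ⟨_, _⟩, _, _⟩ := h
    rw [hD.horizontalJump_eq hq, hD.horizontalJump_eq hq, hD.verticalJump_eq hq,
      hD.verticalJump_eq hq]
    · generalize s (i, j) = a
      generalize s (i + 1, j) = b
      generalize s (i, j + 1) = c
      generalize s (i + 1, j + 1) = e
      revert a b c e
      decide
    all_goals
      unfold KingAdj
      simp only
      omega
  · push Not at h
    have hz : ∀ q : ℤ × ℤ, (i ≤ q.1 ∧ q.1 ≤ i + 1) → (j ≤ q.2 ∧ q.2 ≤ j + 1) → q ∉ D := by
      intro q h1 h2 hq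
      exact absurd (h q hq h1 h2.1) (by omega)
    have h00 := hz (i, j) (by simp) (by simp)
    have h01 := hz (i, j + 1) (by simp) (by simp)
    have h10 := hz (i + 1, j) (by simp) (by simp)
    simp [horizontalJump, verticalJump, h00, h01, h10]

theorem interiorIndicator_fst_succ (hleft : ∀ p ∈ D, -1 ≤ p.1) (i j : ℤ) :
    interiorIndicator D s (i + 1, j)
      = interiorIndicator D s (i, j) + horizontalJump D s (i, j) := by
  unfold interiorIndicator
  rcases le_or_gt (-2) i with hi | hi
  · simp only
    rw [← Finset.insert_Ico_right_eq_Ico_add_one hi, Finset.sum_insert (by simp), add_comm]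
  · have h1 : (i, j) ∉ D := fun h => by have := hleft _ h; simp only at this; omega
    simp only
    rw [Finset.Ico_eq_empty (by omega), Finset.Ico_eq_empty (by omega)]
    simp [horizontalJump, h1]

/-- The indicator integrates jumps along rows; cancellation around plaquettes makes its vertical
increments right too. The induction on the column starts left of `D`, where everything vanishes. -/
theorem IsBoundaryCluster.interiorIndicator_snd_succ (hD : IsBoundaryCluster s D)
    (hleft : ∀ p ∈ D, -1 ≤ p.1) (i j : ℤ) :
    interiorIndicator D s (i, j + 1)
      = interiorIndicator D s (i, j) + verticalJump D s (i, j) := by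
  have hlow : ∀ i : ℤ, i ≤ -2 → interiorIndicator D s (i, j + 1)
      = interiorIndicator D s (i, j) + verticalJump D s (i, j) := by
    intro i hi
    have h1 : (i, j) ∉ D := fun h => by have := hleft _ h; simp only at this; omega
    unfold interiorIndicator
    simp only
    rw [Finset.Ico_eq_empty (by omega)]
    simp [verticalJump, h1]
  rcases le_or_gt i (-2) with hi | hi
  · exact hlow i hi
  · refine Int.leInduction (m := -2) (motive := fun i _ => interiorIndicator D s (i, j + 1)
      = interiorIndicator D s (i, j) + verticalJump D s (i, j)) (hlow _ le_rfl) ?_ i hi.le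
    intro i _ ih
    rw [interiorIndicator_fst_succ hleft, interiorIndicator_fst_succ hleft, ih, add_assoc, add_assoc,
      hD.plaquette]

/-- The inner box `[0, m + 1]²`, outside of which all signs are positive. -/
noncomputable def innerBox (m : ℕ) : Finset (ℤ × ℤ) := Finset.Icc 0 ((m : ℤ) + 1) ×ˢ Finset.Icc 0 ((m : ℤ) + 1)

/-- The outer box `[-1, m + 2]²`, outside of which all letters are `1`. -/
noncomputable def outerBox (m : ℕ) : Finset (ℤ × ℤ) :=
  Finset.Icc (-1) ((m : ℤ) + 2) ×ˢ Finset.Icc (-1) ((m : ℤ) + 2)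

theorem mem_innerBox {m : ℕ} {p : ℤ × ℤ} :
    p ∈ innerBox m ↔ (0 ≤ p.1 ∧ p.1 ≤ m + 1) ∧ (0 ≤ p.2 ∧ p.2 ≤ m + 1) := by
  simp only [innerBox, Finset.mem_product, Finset.mem_Icc]

theorem mem_outerBox {m : ℕ} {p : ℤ × ℤ} :
    p ∈ outerBox m ↔ (-1 ≤ p.1 ∧ p.1 ≤ m + 2) ∧ (-1 ≤ p.2 ∧ p.2 ≤ m + 2) := by
  simp only [outerBox, Finset.mem_product, Finset.mem_Icc]

variable {m : ℕ}

theorem signBoundary_subset_outerBox (hs : ∀ p ∉ innerBox m, s p = 0) {p : ℤ × ℤ}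
    (hp : p ∈ signBoundary s) : p ∈ outerBox m := by
  by_contra h
  rw [mem_outerBox] at h
  have h0 : ∀ q : ℤ × ℤ, KingAdj p q → s q = 0 := by
    rintro q ⟨⟨_, _⟩, _, _⟩
    refine hs q fun hq => h ?_
    rw [mem_innerBox] at hq
    omega
  have hself := h0 p (by unfold KingAdj; omega)
  rcases hp with hp | hp | hp | hp <;> refine hp ?_ <;> rw [hself, h0] <;> unfold KingAdj <;>
    simp only <;> omega

theorem IsBoundaryCluster.neg_one_le (hs : ∀ p ∉ innerBox m, s p = 0)
    (hD : IsBoundaryCluster s D) : ∀ p ∈ D, -1 ≤ p.1 := fun p hp =>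
  (mem_outerBox.1 (signBoundary_subset_outerBox hs (hD.subset p hp))).1.1

/-- Below, above and to the left, all jumps in the sum vanish. To the right, descend the column from
row `m + 2`: it avoids the inner box, so its vertical jumps are zero. -/
theorem IsBoundaryCluster.interiorIndicator_eq_zero (hs : ∀ p ∉ innerBox m, s p = 0)
    (hD : IsBoundaryCluster s D) {p : ℤ × ℤ} (hp : p ∉ innerBox m) :
    interiorIndicator D s p = 0 := by
  have hH : ∀ q : ℤ × ℤ, q ∉ innerBox m → (q.1 + 1, q.2) ∉ innerBox m →
      horizontalJump D s q = 0 := by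
    intro q h1 h2
    simp [horizontalJump, hs _ h1, hs _ h2]
  have hV : ∀ q : ℤ × ℤ, q ∉ innerBox m → (q.1, q.2 + 1) ∉ innerBox m →
      verticalJump D s q = 0 := by
    intro q h1 h2
    simp [verticalJump, hs _ h1, hs _ h2]
  have hrow : ∀ p : ℤ × ℤ, (p.2 < 0 ∨ m + 1 < p.2 ∨ p.1 < 0) → interiorIndicator D s p = 0 := by
    intro p hp
    refine Finset.sum_eq_zero fun l hl => ?_
    rw [Finset.mem_Ico] at hl
    apply hH <;> rw [mem_innerBox] <;> simp only <;> omega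
  by_cases h : p.2 < 0 ∨ m + 1 < p.2 ∨ p.1 < 0
  · exact hrow p h
  · have hp1 : (m : ℤ) + 1 < p.1 := by
      rw [mem_innerBox] at hp
      omega
    have key : ∀ n : ℕ, interiorIndicator D s (p.1, (m : ℤ) + 2 - n) = 0 := by
      intro n
      induction n with
      | zero => exact hrow _ (by simp)
      | succ n ih =>
        have h1 := hD.interiorIndicator_snd_succ (hD.neg_one_le hs) p.1 ((m : ℤ) + 2 - (n + 1))
        rw [hV, add_zero] at h1
        · rw [show (m : ℤ) + 2 - (n + 1) + 1 = m + 2 - n by ring, ih] at h1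
          push_cast
          exact h1.symm
        · rw [mem_innerBox]
          simp only
          omega
        · rw [mem_innerBox]
          simp only
          omega
    have h2 := key ((m : ℤ) + 2 - p.2).toNat
    rwa [Int.toNat_of_nonneg (by omega), sub_sub_cancel] at h2

/-- The relation of being king-adjacent inside the sign boundary. -/
def boundaryStep (s : ℤ × ℤ → ZMod 2) (p q : ℤ × ℤ) : Prop :=
  p ∈ signBoundary s ∧ q ∈ signBoundary s ∧ KingAdj p q

open scoped Classical in
/-- The king-connected component of `p` in the sign boundary. -/
noncomputable def boundaryComponent (m : ℕ) (s : ℤ × ℤ → ZMod 2) (p : ℤ × ℤ) : Finset (ℤ × ℤ) :=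
  (outerBox m).filter fun q => Relation.ReflTransGen (boundaryStep s) p q

theorem reflTransGen_boundaryStep_mem {p q : ℤ × ℤ} (hp : p ∈ signBoundary s)
    (h : Relation.ReflTransGen (boundaryStep s) p q) : q ∈ signBoundary s := by
  rcases h.cases_tail with rfl | ⟨r, _, h⟩
  · exact hp
  · exact h.2.1

theorem mem_boundaryComponent (hs : ∀ p ∉ innerBox m, s p = 0) {p q : ℤ × ℤ}
    (hp : p ∈ signBoundary s) :
    q ∈ boundaryComponent m s p ↔ Relation.ReflTransGen (boundaryStep s) p q := by
  simp only [boundaryComponent, Finset.mem_filter]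
  exact ⟨fun h => h.2, fun h =>
    ⟨signBoundary_subset_outerBox hs (reflTransGen_boundaryStep_mem hp h), h⟩⟩

theorem isBoundaryCluster_boundaryComponent (hs : ∀ p ∉ innerBox m, s p = 0) {p : ℤ × ℤ}
    (hp : p ∈ signBoundary s) : IsBoundaryCluster s (boundaryComponent m s p) where
  subset q hq := reflTransGen_boundaryStep_mem hp ((mem_boundaryComponent hs hp).1 hq)
  closed q hq r hr hqr := by
    rw [mem_boundaryComponent hs hp] at hq ⊢
    exact hq.tail ⟨reflTransGen_boundaryStep_mem hp hq, hr, hqr⟩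

theorem boundaryComponent_eq_of_mem (hs : ∀ p ∉ innerBox m, s p = 0) {p q : ℤ × ℤ}
    (hp : p ∈ signBoundary s) (hq : q ∈ boundaryComponent m s p) :
    boundaryComponent m s q = boundaryComponent m s p := by
  rw [mem_boundaryComponent hs hp] at hq
  have hq' := reflTransGen_boundaryStep_mem hp hq
  have hsymm : Std.Symm (boundaryStep s) := ⟨fun a b h => ⟨h.2.1, h.1, h.2.2.symm⟩⟩
  have hqp : Relation.ReflTransGen (boundaryStep s) q p :=
    symm_of _ hq
  ext r
  rw [mem_boundaryComponent hs hp, mem_boundaryComponent hs hq']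
  exact ⟨fun h => hq.trans h, fun h => hqp.trans h⟩

/-- A negative site is enclosed by a component of the sign boundary. -/
theorem exists_interiorIndicator_ne_zero (hs : ∀ p ∉ innerBox m, s p = 0) {t : ℤ × ℤ}
    (ht : s t ≠ 0) :
    ∃ l < t.1, (l, t.2) ∈ signBoundary s ∧
      interiorIndicator (boundaryComponent m s (l, t.2)) s t ≠ 0 := by
  classical
  have htm : t ∈ innerBox m := by
    by_contra h
    exact ht (hs t h)
  rw [mem_innerBox] at htm
  set g : ℤ → ZMod 2 := fun l => s (l, t.2) + s (l + 1, t.2) with hg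
  -- The sign changes along the row, starting outside the inner box, telescope to `s (i, t.2)`.
  have htel : ∀ i : ℤ, -2 ≤ i → ∑ l ∈ Finset.Ico (-2) i, g l = s (i, t.2) := by
    intro i hi
    refine Int.leInduction (m := -2)
      (motive := fun i _ => ∑ l ∈ Finset.Ico (-2) i, g l = s (i, t.2)) ?_ ?_ i hi
    · rw [Finset.Ico_self, Finset.sum_empty, hs]
      rw [mem_innerBox]
      simp
    · intro i hi ih
      rw [← Finset.insert_Ico_right_eq_Ico_add_one hi, Finset.sum_insert (by simp), ih, hg]
      simp only
      generalize s (i, t.2) = a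
      generalize s (i + 1, t.2) = b
      revert a b
      decide
  have hsum : ∑ l ∈ Finset.Ico (-2) t.1, g l ≠ 0 := by
    rw [htel t.1 (by omega)]
    exact ht
  -- Group the sign changes by boundary component. Some component has a nonzero total, which is its
  -- interior indicator at `t`.
  rw [← Finset.sum_filter_ne_zero, ← Finset.sum_fiberwise_of_maps_to
    (t := ((Finset.Ico (-2) t.1).filter fun l => g l ≠ 0).image
      fun l => boundaryComponent m s (l, t.2))
    (g := fun l => boundaryComponent m s (l, t.2))
    (fun l hl => Finset.mem_image_of_mem _ hl)] at hsum
  obtain ⟨c, hc, hne⟩ := Finset.exists_ne_zero_of_sum_ne_zero hsum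
  obtain ⟨l, hl, rfl⟩ := Finset.mem_image.1 hc
  rw [Finset.mem_filter, Finset.mem_Ico] at hl
  have hgb : ∀ l, g l ≠ 0 → (l, t.2) ∈ signBoundary s := fun l h =>
    (fst_succ_mem_signBoundary (p := (l, t.2)) fun h' => h (ZMod.two_add_eq_zero_of_eq h')).1
  have hlb := hgb l hl.2
  refine ⟨l, hl.1.2, hlb, ?_⟩
  convert hne using 1
  rw [interiorIndicator, Finset.filter_filter, Finset.sum_filter]
  refine Finset.sum_congr rfl fun i _ => ?_
  have hD := isBoundaryCluster_boundaryComponent hs hlb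
  by_cases hi : (i, t.2) ∈ boundaryComponent m s (l, t.2)
  · rw [hD.horizontalJump_eq hi (by unfold KingAdj; omega) (by unfold KingAdj; simp only; omega),
      boundaryComponent_eq_of_mem hs hlb hi]
    by_cases hgi : g i = 0
    · rw [if_neg fun h => h.1 hgi]
      exact hgi
    · rw [if_pos ⟨hgi, rfl⟩]
  · rw [if_neg, horizontalJump, if_neg fun h => hi h.1]
    rintro ⟨h1, h2⟩
    refine hi ?_
    rw [← h2, mem_boundaryComponent hs (hgb i h1)]

/-- The enclosing cluster lies in a family whose size is bounded in terms of `D.card` alone,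
uniformly in `m`; the Peierls sum rests on this. -/
theorem exists_mem_kingClusters (hs : ∀ p ∉ innerBox m, s p = 0) {t : ℤ × ℤ} (ht : s t ≠ 0) :
    ∃ D : Finset (ℤ × ℤ), IsBoundaryCluster s D ∧ D.Nonempty ∧ D ⊆ outerBox m ∧
      D ∈ kingClusters t D.card := by
  obtain ⟨l, hl, hlb, hne⟩ := exists_interiorIndicator_ne_zero hs ht
  set D := boundaryComponent m s (l, t.2) with hDdef
  have hD := isBoundaryCluster_boundaryComponent hs hlb
  have hlD : (l, t.2) ∈ D := (mem_boundaryComponent hs hlb).2 Relation.ReflTransGen.refl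
  refine ⟨D, hD, ⟨_, hlD⟩,
    fun q hq => signBoundary_subset_outerBox hs (hD.subset q hq), ?_⟩
  obtain ⟨w, hw, hlen, hvis⟩ := exists_visit_eq D (l, t.2) hlD (by
    intro S hS hlS hcl
    refine Finset.Subset.antisymm hS fun q hq => ?_
    have h1 := (mem_boundaryComponent hs hlb).1 hq
    induction h1 with
    | refl => exact hlS
    | tail h2 h3 ih =>
      exact hcl _ (ih ((mem_boundaryComponent hs hlb).2 h2)) _ hq h3.2.2)
  -- Otherwise the indicator would keep its nonzero value along the row beyond the inner box. So `D`
  -- straddles `t`, and the length of its walk bounds `t.1 - l`.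
  obtain ⟨r, hrt, hrD⟩ : ∃ r, t.1 ≤ r ∧ (r, t.2) ∈ D := by
    by_contra! h
    have hconst : ∀ n : ℕ, interiorIndicator D s (t.1 + n, t.2) = interiorIndicator D s t := by
      intro n
      induction n with
      | zero => simp
      | succ n ih =>
        push_cast
        rw [← add_assoc, interiorIndicator_fst_succ (hD.neg_one_le hs), ih, horizontalJump,
          if_neg fun h' => h _ (by omega) h'.1, add_zero]
    refine hne ((hconst (m + 2)).symm.trans (hD.interiorIndicator_eq_zero hs ?_))
    have htm : t ∈ innerBox m := by
      by_contra h
      exact ht (hs t h)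
    rw [mem_innerBox] at htm ⊢
    push_cast
    omega
  rw [← hvis] at hrD
  have hdist := fst_le_of_mem_visit hw hrD
  have hpos : 0 < D.card := Finset.card_pos.2 ⟨_, hlD⟩
  simp only [hlen] at hdist
  have hcl := visit_mem_kingClusters (t := t) (k := D.card) (j := (t.1 - l).toNat) (by omega) hw hlen
  rwa [Int.toNat_of_nonneg (by omega), sub_sub_cancel, hvis] at hcl

end Contours

/-! ### The Peierls estimate. -/

section Peierls

/-- Configurations of the iceberg model on the square lattice that are positive outside
`[0, m + 1]²` and equal to `1` outside `[-1, m + 2]²`. -/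
structure IsPlusConfig (M m : ℕ) (x : ℤ × ℤ → ℤ) : Prop where
  abs_le : ∀ p, |x p| ≤ M
  horizontal : ∀ p, icebergAllowed (x p) (x (p.1 + 1, p.2))
  vertical : ∀ p, icebergAllowed (x p) (x (p.1, p.2 + 1))
  pos : ∀ p ∉ innerBox m, 0 < x p
  eq_one : ∀ p ∉ outerBox m, x p = 1

/-- The indicator function of the negative sites. -/
def negSign (x : ℤ × ℤ → ℤ) (p : ℤ × ℤ) : ZMod 2 := if x p < 0 then 1 else 0

variable {M m : ℕ} {x : ℤ × ℤ → ℤ}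

theorem negSign_eq_one_iff {p : ℤ × ℤ} : negSign x p = 1 ↔ x p < 0 := by
  unfold negSign
  split_ifs with h <;> simp [h]

theorem negSign_ne_iff {p q : ℤ × ℤ} : negSign x p ≠ negSign x q ↔ ¬ (x p < 0 ↔ x q < 0) := by
  unfold negSign
  split_ifs with h1 h2 h2 <;> simp [h1, h2]

theorem icebergAllowed.abs_eq_one {a b : ℤ} (h : icebergAllowed a b) (hab : ¬ (a < 0 ↔ b < 0)) :
    |a| = 1 ∧ |b| = 1 := by
  unfold icebergAllowed at h
  rcases h with h | h | ⟨rfl, rfl⟩ | ⟨rfl, rfl⟩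
  · omega
  · omega
  · simp
  · simp

theorem icebergAllowed.ne_zero {a b : ℤ} (h : icebergAllowed a b) : a ≠ 0 := by
  unfold icebergAllowed at h
  omega

theorem IsPlusConfig.negSign_eq_zero (hx : IsPlusConfig M m x) :
    ∀ p ∉ innerBox m, negSign x p = 0 := fun p hp => by
  have := hx.pos p hp
  simp [negSign, this.le]

theorem IsPlusConfig.abs_eq_one (hx : IsPlusConfig M m x) {p : ℤ × ℤ}
    (hp : p ∈ signBoundary (negSign x)) : |x p| = 1 := by
  rcases hp with h | h | h | h <;> rw [negSign_ne_iff] at h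
  · exact ((hx.horizontal p).abs_eq_one h).1
  · have := hx.horizontal (p.1 - 1, p.2)
    simp only [sub_add_cancel] at this
    exact (this.abs_eq_one (by tauto)).2
  · exact ((hx.vertical p).abs_eq_one h).1
  · have := hx.vertical (p.1, p.2 - 1)
    simp only [sub_add_cancel] at this
    exact (this.abs_eq_one (by tauto)).2

/-- The configuration obtained by changing the signs in the interior of the contours in `D`, and
putting the letters `u + 1` on the sites of `D`. -/
noncomputable def flipCluster (D : Finset (ℤ × ℤ)) (u : D → Fin M) (x : ℤ × ℤ → ℤ) (p : ℤ × ℤ) :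
    ℤ :=
  (if negSign x p + interiorIndicator D (negSign x) p = 1 then -1 else 1) *
    if h : p ∈ D then ((u ⟨p, h⟩ : ℕ) : ℤ) + 1 else |x p|

variable {D : Finset (ℤ × ℤ)} {u : D → Fin M}

theorem IsPlusConfig.abs_pos (hx : IsPlusConfig M m x) (p : ℤ × ℤ) : 0 < |x p| :=
  _root_.abs_pos.2 (hx.horizontal p).ne_zero

theorem IsPlusConfig.magnitude_pos (hx : IsPlusConfig M m x) (u : D → Fin M) (p : ℤ × ℤ) :
    0 < if h : p ∈ D then ((u ⟨p, h⟩ : ℕ) : ℤ) + 1 else |x p| := by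
  split_ifs with h
  · positivity
  · exact hx.abs_pos p

theorem IsPlusConfig.flipCluster_neg_iff (hx : IsPlusConfig M m x) (u : D → Fin M) (p : ℤ × ℤ) :
    flipCluster D u x p < 0 ↔ negSign x p + interiorIndicator D (negSign x) p = 1 := by
  have h := hx.magnitude_pos u p
  unfold flipCluster
  generalize (if h : p ∈ D then ((u ⟨p, h⟩ : ℕ) : ℤ) + 1 else |x p|) = c at h ⊢
  split_ifs with h1 <;> simp only [h1, iff_true, iff_false] <;> omega

theorem IsPlusConfig.abs_flipCluster (hx : IsPlusConfig M m x) (u : D → Fin M) (p : ℤ × ℤ) :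
    |flipCluster D u x p| = if h : p ∈ D then ((u ⟨p, h⟩ : ℕ) : ℤ) + 1 else |x p| := by
  have h := hx.magnitude_pos u p
  unfold flipCluster
  rw [abs_mul, abs_of_pos h]
  split_ifs <;> simp

theorem icebergAllowed_of_signs {a b : ℤ} (ha : a ≠ 0) (hb : b ≠ 0)
    (h : ¬ (a < 0 ↔ b < 0) → |a| = 1 ∧ |b| = 1) : icebergAllowed a b := by
  unfold icebergAllowed
  by_cases hab : a < 0 ↔ b < 0
  · omega
  · obtain ⟨h1, h2⟩ := h hab
    rcases (abs_eq zero_le_one).1 h1 with rfl | rfl <;>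
      rcases (abs_eq zero_le_one).1 h2 with rfl | rfl <;> simp_all

/-- With `a`, `b` the old signs and `i`, `j` the indicators, a sign change that survives the flip is
one that the jump `g` of the cluster does not cancel. -/
theorem ZMod.two_sign_change {a b i j g : ZMod 2} (hij : j = i + g)
    (hne : ¬ (a + i = 1 ↔ b + j = 1)) : a + b + g = 1 := by
  revert a b i j g
  decide

/-- Sign changes on edges touching `D` are cancelled, so sites of `D` may carry any magnitude. A
surviving change sits on the sign boundary off `D`, where the magnitudes are still 1. -/
theorem IsPlusConfig.flipCluster (hx : IsPlusConfig M m x)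
    (hD : IsBoundaryCluster (negSign x) D) (u : D → Fin M) :
    IsPlusConfig M m (flipCluster D u x) := by
  have hs := hx.negSign_eq_zero
  have hleft := hD.neg_one_le hs
  have hne : ∀ p, _root_.flipCluster D u x p ≠ 0 := by
    intro p h
    have h1 := hx.abs_flipCluster u p
    have h2 := hx.magnitude_pos u p
    rw [h, abs_zero] at h1
    omega
  have habs : ∀ p ∉ D, p ∈ signBoundary (negSign x) → |_root_.flipCluster D u x p| = 1 := by
    intro p hp hb
    rw [hx.abs_flipCluster, dif_neg hp, hx.abs_eq_one hb]
  have hadj : ∀ p : ℤ × ℤ, KingAdj p p := fun p => by unfold KingAdj; omega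
  have hadj1 : ∀ p : ℤ × ℤ, KingAdj p (p.1 + 1, p.2) := fun p => by
    unfold KingAdj; simp only; omega
  have hadj2 : ∀ p : ℤ × ℤ, KingAdj p (p.1, p.2 + 1) := fun p => by
    unfold KingAdj; simp only; omega
  refine ⟨fun p => ?_, fun p => ?_, fun p => ?_, fun p hp => ?_, fun p hp => ?_⟩
  · rw [hx.abs_flipCluster]
    split_ifs with h
    · have := (u ⟨p, h⟩).isLt
      omega
    · exact hx.abs_le p
  · refine icebergAllowed_of_signs (hne _) (hne _) fun h => ?_
    rw [hx.flipCluster_neg_iff, hx.flipCluster_neg_iff] at h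
    have h1 := ZMod.two_sign_change (interiorIndicator_fst_succ hleft p.1 p.2) h
    have hpD : p ∉ D := fun hp => by
      rw [hD.horizontalJump_eq hp (hadj p) (hadj1 p), CharTwo.add_self_eq_zero] at h1
      exact zero_ne_one h1
    have hb : negSign x p ≠ negSign x (p.1 + 1, p.2) := by
      intro h2
      simp [horizontalJump, hpD, ZMod.two_add_eq_zero_of_eq h2] at h1
    obtain ⟨h3, h4⟩ := fst_succ_mem_signBoundary hb
    exact ⟨habs _ hpD h3, habs _ (fun h5 => hpD (hD.closed _ h5 _ h3 (hadj1 p).symm)) h4⟩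
  · refine icebergAllowed_of_signs (hne _) (hne _) fun h => ?_
    rw [hx.flipCluster_neg_iff, hx.flipCluster_neg_iff] at h
    have h1 := ZMod.two_sign_change (hD.interiorIndicator_snd_succ hleft p.1 p.2) h
    have hpD : p ∉ D := fun hp => by
      rw [hD.verticalJump_eq hp (hadj p) (hadj2 p), CharTwo.add_self_eq_zero] at h1
      exact zero_ne_one h1
    have hb : negSign x p ≠ negSign x (p.1, p.2 + 1) := by
      intro h2
      simp [verticalJump, hpD, ZMod.two_add_eq_zero_of_eq h2] at h1
    obtain ⟨h3, h4⟩ := snd_succ_mem_signBoundary hb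
    exact ⟨habs _ hpD h3, habs _ (fun h5 => hpD (hD.closed _ h5 _ h3 (hadj2 p).symm)) h4⟩
  · have h1 : ¬ _root_.flipCluster D u x p < 0 := by
      rw [hx.flipCluster_neg_iff, hs p hp, hD.interiorIndicator_eq_zero hs hp]
      decide
    have := hne p
    omega
  · have hp' : p ∉ innerBox m := fun h => hp (by
      rw [mem_innerBox] at h
      rw [mem_outerBox]
      omega)
    have hpD : p ∉ D := fun h => hp (signBoundary_subset_outerBox hs (hD.subset p h))
    unfold _root_.flipCluster
    rw [hs p hp', hD.interiorIndicator_eq_zero hs hp', dif_neg hpD, hx.eq_one p hp]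
    simp

theorem eq_of_abs_eq_of_neg_iff {a b : ℤ} (h : |a| = |b|) (hneg : a < 0 ↔ b < 0) : a = b := by
  rcases abs_eq_abs.1 h with rfl | rfl
  · rfl
  · omega

/-- The signs on `D` determine the interior, so the flip can be undone. Old magnitudes were 1 on `D`
and are unchanged off `D`; new magnitudes on `D` reveal `u`. -/
theorem flipCluster_injective {x₁ x₂ : ℤ × ℤ → ℤ} {u₁ u₂ : D → Fin M}
    (h₁ : IsPlusConfig M m x₁) (h₂ : IsPlusConfig M m x₂)
    (hD₁ : IsBoundaryCluster (negSign x₁) D) (hD₂ : IsBoundaryCluster (negSign x₂) D)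
    (hsign : ∀ p ∈ D, negSign x₁ p = negSign x₂ p)
    (h : flipCluster D u₁ x₁ = flipCluster D u₂ x₂) : x₁ = x₂ ∧ u₁ = u₂ := by
  have habs : ∀ p, (if h : p ∈ D then ((u₁ ⟨p, h⟩ : ℕ) : ℤ) + 1 else |x₁ p|)
      = if h : p ∈ D then ((u₂ ⟨p, h⟩ : ℕ) : ℤ) + 1 else |x₂ p| := by
    intro p
    rw [← h₁.abs_flipCluster, ← h₂.abs_flipCluster, h]
  constructor
  · funext p
    refine eq_of_abs_eq_of_neg_iff ?_ ?_
    · by_cases hp : p ∈ D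
      · rw [h₁.abs_eq_one (hD₁.subset p hp), h₂.abs_eq_one (hD₂.subset p hp)]
      · simpa [hp] using habs p
    · have h3 := h₁.flipCluster_neg_iff u₁ p
      rw [h, h₂.flipCluster_neg_iff u₂ p, interiorIndicator_congr hsign] at h3
      rw [← negSign_eq_one_iff, ← negSign_eq_one_iff]
      generalize interiorIndicator D (negSign x₂) p = c at h3
      generalize negSign x₁ p = a at h3
      generalize negSign x₂ p = b at h3
      revert a b c
      decide
  · funext ⟨p, hp⟩
    have := habs p
    simp only [hp, dif_pos] at this
    apply Fin.ext
    omega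

theorem finite_isPlusConfig (M m : ℕ) : {x | IsPlusConfig M m x}.Finite := by
  refine Set.Finite.of_finite_image (f := (outerBox m).restrict (π := fun _ => ℤ))
    (Set.Finite.subset (Set.Finite.pi' fun _ : outerBox m => Set.finite_Icc (-(M : ℤ)) M) ?_) ?_
  · rintro _ ⟨x, hx, rfl⟩ p
    exact Set.mem_Icc.2 (_root_.abs_le.1 (hx.abs_le p))
  · intro x hx y hy h
    funext p
    by_cases hp : p ∈ outerBox m
    · exact congrFun h ⟨p, hp⟩
    · rw [hx.eq_one p hp, hy.eq_one p hp]

/-- The finite set of configurations with plus boundary condition. -/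
noncomputable def plusConfigs (M m : ℕ) : Finset (ℤ × ℤ → ℤ) := (finite_isPlusConfig M m).toFinset

theorem mem_plusConfigs : x ∈ plusConfigs M m ↔ IsPlusConfig M m x := by simp [plusConfigs]

open scoped Classical in
/-- The configurations for which `D` is a cluster of the sign boundary with sign pattern `τ`. -/
noncomputable def plusConfigsWithCluster (M m : ℕ) (D : Finset (ℤ × ℤ)) (τ : D → ZMod 2) :
    Finset (ℤ × ℤ → ℤ) :=
  (plusConfigs M m).filter fun x =>
    IsBoundaryCluster (negSign x) D ∧ ∀ p : D, negSign x p = τ p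

/-- The energy–entropy gain: erasing the cluster turns one configuration into `M ^ D.card` of them,
without collisions. -/
theorem card_plusConfigsWithCluster_le (M m : ℕ) (D : Finset (ℤ × ℤ)) (τ : D → ZMod 2) :
    (plusConfigsWithCluster M m D τ).card * M ^ D.card ≤ (plusConfigs M m).card := by
  classical
  have h1 : (plusConfigsWithCluster M m D τ ×ˢ (Finset.univ : Finset (D → Fin M))).card
      = (plusConfigsWithCluster M m D τ).card * M ^ D.card := by
    simp [Finset.card_product]
  rw [← h1]
  refine Finset.card_le_card_of_injOn (fun xu => flipCluster D xu.2 xu.1) ?_ ?_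
  · rintro ⟨x, u⟩ hxu
    simp only [Finset.coe_product, Set.mem_prod, Finset.mem_coe, plusConfigsWithCluster,
      Finset.mem_filter, mem_plusConfigs] at hxu ⊢
    exact hxu.1.1.flipCluster hxu.1.2.1 u
  · rintro ⟨x₁, u₁⟩ h₁ ⟨x₂, u₂⟩ h₂ h
    simp only [Finset.coe_product, Set.mem_prod, Finset.mem_coe, plusConfigsWithCluster,
      Finset.mem_filter, mem_plusConfigs] at h₁ h₂
    obtain ⟨rfl, rfl⟩ := flipCluster_injective h₁.1.1 h₂.1.1 h₁.1.2.1 h₂.1.2.1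
      (fun p hp => (h₁.1.2.2 ⟨p, hp⟩).trans (h₂.1.2.2 ⟨p, hp⟩).symm) h
    rfl

theorem sum_Icc_inv_pow_le (K : ℕ) : ∑ k ∈ Finset.Icc 1 K, (1 / 17 : ℝ) ^ k ≤ 1 / 16 := by
  have : ∑ k ∈ Finset.Icc 1 K, (1 / 17 : ℝ) ^ k = 1 / 16 - (1 / 17) ^ K / 16 := by
    induction K with
    | zero => simp
    | succ K ih =>
      rw [Finset.sum_Icc_succ_top (by omega), ih]
      ring
  rw [this]
  have : (0 : ℝ) ≤ (1 / 17) ^ K / 16 := by positivity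
  linarith

open scoped Classical in
/-- Peierls' estimate: with plus boundary condition, negative sites are rare. -/
theorem card_filter_neg_le (hM : 5508 ≤ M) (t : ℤ × ℤ) :
    (((plusConfigs M m).filter fun x => x t < 0).card : ℝ) ≤ 1 / 16 * (plusConfigs M m).card := by
  set Ω := plusConfigs M m with hΩ
  -- Union bound over the size `k`, the cluster `D` and its sign pattern `τ`.
  have hsub : (Ω.filter fun x => x t < 0) ⊆
      (Finset.Icc 1 (outerBox m).card).biUnion fun k =>
        ((kingClusters t k).filter fun D => D.card = k).biUnion fun D =>
          Finset.univ.biUnion fun τ : D → ZMod 2 => plusConfigsWithCluster M m D τ := by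
    intro x hx
    rw [Finset.mem_filter, hΩ, mem_plusConfigs] at hx
    obtain ⟨D, hD, hne, hsub, hmem⟩ := exists_mem_kingClusters hx.1.negSign_eq_zero
      (t := t) (by rw [negSign_eq_one_iff.2 hx.2]; exact one_ne_zero)
    simp only [Finset.mem_biUnion, Finset.mem_Icc, Finset.mem_filter, Finset.mem_univ, true_and]
    refine ⟨D.card, ⟨hne.card_pos, Finset.card_le_card hsub⟩, D, ⟨hmem, rfl⟩,
      fun p => negSign x p, ?_⟩
    rw [plusConfigsWithCluster, Finset.mem_filter, mem_plusConfigs]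
    exact ⟨hx.1, hD, fun _ => rfl⟩
  have hM0 : (0 : ℝ) < M := by
    have : 0 < M := by omega
    exact_mod_cast this
  have hcl : ∀ (D : Finset (ℤ × ℤ)) (τ : D → ZMod 2),
      ((plusConfigsWithCluster M m D τ).card : ℝ) ≤ Ω.card / (M : ℝ) ^ D.card := by
    intro D τ
    rw [le_div_iff₀ (by positivity)]
    exact_mod_cast card_plusConfigsWithCluster_le M m D τ
  have hstep : ∀ k ∈ Finset.Icc 1 (outerBox m).card,
      ((((kingClusters t k).filter fun D => D.card = k).biUnion fun D =>
          Finset.univ.biUnion fun τ : D → ZMod 2 => plusConfigsWithCluster M m D τ).card : ℝ)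
        ≤ (1 / 17) ^ k * Ω.card := by
    intro k hk
    rw [Finset.mem_Icc] at hk
    have h1 : ∀ D ∈ (kingClusters t k).filter fun D => D.card = k,
        ((Finset.univ.biUnion fun τ : D → ZMod 2 => plusConfigsWithCluster M m D τ).card : ℝ)
          ≤ 2 ^ k * (Ω.card / (M : ℝ) ^ k) := by
      intro D hD
      have hDk := (Finset.mem_filter.1 hD).2
      calc ((Finset.univ.biUnion fun τ : D → ZMod 2 => plusConfigsWithCluster M m D τ).card : ℝ)
          ≤ ∑ τ : D → ZMod 2, ((plusConfigsWithCluster M m D τ).card : ℝ) := by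
            exact_mod_cast Finset.card_biUnion_le
        _ ≤ ∑ _τ : D → ZMod 2, Ω.card / (M : ℝ) ^ D.card :=
            Finset.sum_le_sum fun τ _ => hcl D τ
        _ = 2 ^ k * (Ω.card / (M : ℝ) ^ k) := by
            rw [Finset.sum_const, nsmul_eq_mul, Finset.card_univ, Fintype.card_fun, ZMod.card,
              Fintype.card_coe, hDk]
            push_cast
            rfl
    calc _ ≤ ∑ D ∈ (kingClusters t k).filter fun D => D.card = k,
          ((Finset.univ.biUnion fun τ : D → ZMod 2 => plusConfigsWithCluster M m D τ).card : ℝ) := by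
            exact_mod_cast Finset.card_biUnion_le
      _ ≤ ((kingClusters t k).filter fun D => D.card = k).card
            • (2 ^ k * (Ω.card / (M : ℝ) ^ k)) := Finset.sum_le_card_nsmul _ _ _ h1
      _ ≤ 162 ^ k * (2 ^ k * (Ω.card / (M : ℝ) ^ k)) := by
            rw [nsmul_eq_mul]
            refine mul_le_mul_of_nonneg_right ?_ (by positivity)
            exact_mod_cast (Finset.card_filter_le _ _).trans (card_kingClusters_le t hk.1)
      _ = (324 / M) ^ k * Ω.card := by
            rw [show (324 : ℝ) = 162 * 2 by norm_num, div_pow, mul_pow]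
            ring
      _ ≤ (1 / 17) ^ k * Ω.card := by
            -- `5508 = 17 · 324`, with `324 = 162 · 2` accounting for clusters and sign patterns.
            have h2 : (324 : ℝ) / M ≤ 1 / 17 := by
              have : (5508 : ℝ) ≤ M := by exact_mod_cast hM
              rw [div_le_iff₀ hM0]
              linarith
            exact mul_le_mul_of_nonneg_right (pow_le_pow_left₀ (by positivity) h2 k) (by positivity)
  calc ((Ω.filter fun x => x t < 0).card : ℝ)
      ≤ ∑ k ∈ Finset.Icc 1 (outerBox m).card,
        ((((kingClusters t k).filter fun D => D.card = k).biUnion fun D =>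
          Finset.univ.biUnion fun τ : D → ZMod 2 =>
            plusConfigsWithCluster M m D τ).card : ℝ) := by
          exact_mod_cast (Finset.card_le_card hsub).trans Finset.card_biUnion_le
    _ ≤ ∑ k ∈ Finset.Icc 1 (outerBox m).card, (1 / 17) ^ k * (Ω.card : ℝ) :=
        Finset.sum_le_sum hstep
    _ ≤ 1 / 16 * Ω.card := by
        rw [← Finset.sum_mul]
        exact mul_le_mul_of_nonneg_right (sum_Icc_inv_pow_le _) (by positivity)

end Peierls

/-! ### Imposing the plus boundary condition. -/

section Ring

variable {M m : ℕ}

/-- The projection of an integer to the interval `[1, m]`. -/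
noncomputable def clampTo (m : ℕ) (i : ℤ) : ℤ := max 1 (min i m)

/-- Membership in the square `[1, m]²`. -/
def InCore (m : ℕ) (p : ℤ × ℤ) : Prop := (1 ≤ p.1 ∧ p.1 ≤ m) ∧ (1 ≤ p.2 ∧ p.2 ≤ m)

open scoped Classical in
/-- The configuration `x` on `[1, m]²`, surrounded by a layer of letters `±1` copying the signs
of `x`, and by letters `1` outside. -/
noncomputable def surround (m : ℕ) (x : ℤ × ℤ → ℤ) (p : ℤ × ℤ) : ℤ :=
  if InCore m p then x p
  else if p ∈ innerBox m then (x (clampTo m p.1, clampTo m p.2)).sign else 1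

theorem surround_of_inCore {x : ℤ × ℤ → ℤ} {p : ℤ × ℤ} (hp : InCore m p) :
    surround m x p = x p := if_pos hp

theorem surround_of_neighbor {x : ℤ × ℤ → ℤ} {p q : ℤ × ℤ} (hp : InCore m p) (hq : ¬ InCore m q)
    (hpq : (q.2 = p.2 ∧ (q.1 = p.1 + 1 ∨ q.1 = p.1 - 1)) ∨
      (q.1 = p.1 ∧ (q.2 = p.2 + 1 ∨ q.2 = p.2 - 1))) :
    surround m x q = (x p).sign := by
  have hin : q ∈ innerBox m := by
    rw [mem_innerBox]
    unfold InCore at hp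
    omega
  have hc : (clampTo m q.1, clampTo m q.2) = p := by
    unfold InCore at hp hq
    refine Prod.ext ?_ ?_ <;> simp only [clampTo] <;> omega
  rw [surround, if_neg hq, if_pos hin, hc]

theorem abs_surround_of_not_inCore {x : ℤ × ℤ → ℤ} (hx0 : ∀ p, x p ≠ 0) {p : ℤ × ℤ}
    (hp : ¬ InCore m p) : |surround m x p| = 1 := by
  rw [surround, if_neg hp]
  split_ifs
  · rcases lt_or_gt_of_ne (hx0 (clampTo m p.1, clampTo m p.2)) with h | h
    · simp [Int.sign_eq_neg_one_of_neg h]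
    · simp [Int.sign_eq_one_of_pos h]
  · simp

/-- Across the border of the square, the layer repeats the sign of the adjacent letter. Outside the
square all letters are `±1`, and these may be adjacent in any combination. -/
theorem isPlusConfig_surround {x : ℤ × ℤ → ℤ} (hM : ∀ p, |x p| ≤ M)
    (hh : ∀ p, icebergAllowed (x p) (x (p.1 + 1, p.2)))
    (hv : ∀ p, icebergAllowed (x p) (x (p.1, p.2 + 1))) : IsPlusConfig M m (surround m x) := by
  have hx0 : ∀ p, x p ≠ 0 := fun p => (hh p).ne_zero
  have habs := fun {p} => abs_surround_of_not_inCore (m := m) hx0 (p := p)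
  have hne : ∀ p, surround m x p ≠ 0 := by
    intro p
    by_cases hp : InCore m p
    · rw [surround_of_inCore hp]; exact hx0 p
    · intro h
      have := habs hp
      rw [h] at this
      simp at this
  have hsign : ∀ a : ℤ, (a.sign < 0 ↔ a < 0) := fun a => by
    rcases lt_trichotomy a 0 with h | h | h
    · simp [Int.sign_eq_neg_one_of_neg h, h]
    · simp [h]
    · simp [Int.sign_eq_one_of_pos h, h.le]
  have hall : ∀ p q : ℤ × ℤ, ((q.2 = p.2 ∧ q.1 = p.1 + 1) ∨ (q.1 = p.1 ∧ q.2 = p.2 + 1)) →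
      icebergAllowed (x p) (x q) → icebergAllowed (surround m x p) (surround m x q) := by
    intro p q hpq hal
    refine icebergAllowed_of_signs (hne p) (hne q) fun h => ?_
    by_cases hp : InCore m p <;> by_cases hq : InCore m q
    · rw [surround_of_inCore hp, surround_of_inCore hq] at h ⊢
      exact hal.abs_eq_one h
    · rw [surround_of_inCore hp, surround_of_neighbor hp hq (by omega), hsign] at h
      exact absurd Iff.rfl h
    · rw [surround_of_inCore hq, surround_of_neighbor hq hp (by omega), hsign] at h
      exact absurd Iff.rfl h
    · exact ⟨habs hp, habs hq⟩
  refine ⟨fun p => ?_, fun p => hall _ _ (by simp) (hh p), fun p => hall _ _ (by simp) (hv p),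
    fun p hp => ?_, fun p hp => ?_⟩
  · by_cases hp : InCore m p
    · rw [surround_of_inCore hp]; exact hM p
    · rw [habs hp]
      have h1 := hM p
      have h2 := abs_pos.2 (hx0 p)
      omega
  · have hp' : ¬ InCore m p := fun h => hp (by
      rw [mem_innerBox]
      unfold InCore at h
      omega)
    rw [surround, if_neg hp', if_neg hp]
    exact one_pos
  · have hp1 : p ∉ innerBox m := fun h => hp (by
      rw [mem_innerBox] at h
      rw [mem_outerBox]
      omega)
    have hp2 : ¬ InCore m p := fun h => hp1 (by
      rw [mem_innerBox]
      unfold InCore at h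
      omega)
    rw [surround, if_neg hp2, if_neg hp1]

theorem iceberg_abs_le (a : IcebergAlphabet M) : |a.1| ≤ M := by
  have := (Finset.mem_erase.1 a.2).2
  exact abs_le.2 (Finset.mem_Icc.1 this)

theorem mem_icebergAlphabet {a : ℤ} (h0 : a ≠ 0) (h : |a| ≤ M) :
    a ∈ (Finset.Icc (-(M : ℤ)) (M : ℤ)).erase 0 :=
  Finset.mem_erase.2 ⟨h0, Finset.mem_Icc.2 (abs_le.1 h)⟩

theorem mem_iceberg {x : (Fin 2 → ℤ) → IcebergAlphabet M} :
    x ∈ (iceberg M).carrier ↔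
      ∀ (i : Fin 2) (t : Fin 2 → ℤ), icebergAllowed (x t).1 (x (t + Pi.single i 1)).1 := by
  change (∀ (i : Fin 2) (t : Fin 2 → ℤ), ¬ ¬ icebergAllowed _ _) ↔ _
  simp only [not_not]

/-- Surrounding is injective because the pattern can be read back on the square; hence the boundary
condition costs no entropy. -/
theorem ncard_languageOfShape_le_card_plusConfigs (M m : ℕ) :
    (languageOfShape (iceberg M) (box fun _ => m)).ncard ≤ (plusConfigs M m).card := by
  have hx : ∀ w : languageOfShape (iceberg M) (box fun _ => m),
      ∃ x ∈ (iceberg M).carrier, (box fun _ => m).restrict x = w.1 := fun w => w.2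
  choose x hxX hxw using hx
  let z : languageOfShape (iceberg M) (box fun _ => m) → ℤ × ℤ → ℤ :=
    fun w p => (x w ![p.1, p.2]).1
  have h0 : ∀ p : ℤ × ℤ, ![p.1, p.2] + Pi.single (0 : Fin 2) 1 = ![p.1 + 1, p.2] := by
    intro p; funext i; fin_cases i <;> simp
  have h1 : ∀ p : ℤ × ℤ, ![p.1, p.2] + Pi.single (1 : Fin 2) 1 = ![p.1, p.2 + 1] := by
    intro p; funext i; fin_cases i <;> simp
  have hz : ∀ w, IsPlusConfig M m (surround m (z w)) := by
    intro w
    have hw := mem_iceberg.1 (hxX w)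
    refine isPlusConfig_surround (fun p => iceberg_abs_le _) (fun p => ?_) fun p => ?_
    · have := hw 0 ![p.1, p.2]
      rwa [h0] at this
    · have := hw 1 ![p.1, p.2]
      rwa [h1] at this
  have hinj : Function.Injective fun w =>
      (⟨surround m (z w), mem_plusConfigs.2 (hz w)⟩ : plusConfigs M m) := by
    intro v w h
    apply Subtype.ext
    rw [← hxw v, ← hxw w]
    funext ⟨t, ht⟩
    have ht' := mem_box.1 ht
    have hcore : InCore m (t 0, t 1) := ⟨ht' 0, ht' 1⟩
    have h2 := congrFun (congrArg Subtype.val h) (t 0, t 1)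
    simp only [surround_of_inCore hcore, z] at h2
    have h3 : ![t 0, t 1] = t := by funext i; fin_cases i <;> rfl
    rw [h3] at h2
    exact Subtype.ext h2
  have := Nat.card_le_card_of_injective _ hinj
  simpa [Nat.card_coe_set_eq] using this

end Ring

/-! ### Passing to the torus. -/

section TorusConfigs

variable {M m : ℕ}

/-- The planar site represented by a point of the torus of side `m + 5`. -/
def torusSite (t : Fin 2 → ZMod (m + 5)) : ℤ × ℤ := (((t 0).val : ℤ) - 2, ((t 1).val : ℤ) - 2)

theorem ZMod.val_add_one_cases (a : ZMod (m + 5)) :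
    (a + 1).val = a.val + 1 ∨ (a.val = m + 4 ∧ (a + 1).val = 0) := by
  have h1 : (1 : ZMod (m + 5)).val = 1 := by
    rw [ZMod.val_one_eq_one_mod]
    exact Nat.mod_eq_of_lt (by omega)
  have h2 := ZMod.val_lt a
  rw [ZMod.val_add, h1]
  by_cases h : a.val + 1 < m + 5
  · exact Or.inl (Nat.mod_eq_of_lt h)
  · have h3 : a.val = m + 4 := by omega
    refine Or.inr ⟨h3, ?_⟩
    rw [h3]
    exact Nat.mod_self _

/-- At the seam, column `m + 2` is followed by column `-2` instead of `m + 3`; both lie outside the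
outer box and carry the letter 1. The side `m + 5` is the width `m + 4` of the outer box plus this
separating column. -/
theorem IsPlusConfig.apply_torusSite_zero {x : ℤ × ℤ → ℤ} (hx : IsPlusConfig M m x)
    (t : Fin 2 → ZMod (m + 5)) :
    x (torusSite (t + Pi.single 0 1)) = x ((torusSite t).1 + 1, (torusSite t).2) := by
  unfold torusSite
  simp only [Pi.add_apply, Pi.single_eq_same, ne_eq, one_ne_zero, not_false_eq_true,
    Pi.single_eq_of_ne, add_zero]
  rcases ZMod.val_add_one_cases (t 0) with h | ⟨h1, h2⟩
  · rw [h]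
    congr 2
    push_cast
    ring
  · rw [h1, h2, hx.eq_one, hx.eq_one] <;> rw [mem_outerBox] <;> dsimp only <;> omega

theorem IsPlusConfig.apply_torusSite_one {x : ℤ × ℤ → ℤ} (hx : IsPlusConfig M m x)
    (t : Fin 2 → ZMod (m + 5)) :
    x (torusSite (t + Pi.single 1 1)) = x ((torusSite t).1, (torusSite t).2 + 1) := by
  unfold torusSite
  simp only [Pi.add_apply, Pi.single_eq_same, ne_eq, zero_ne_one, not_false_eq_true,
    Pi.single_eq_of_ne, add_zero]
  rcases ZMod.val_add_one_cases (t 1) with h | ⟨h1, h2⟩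
  · rw [h]
    congr 2
    push_cast
    ring
  · rw [h1, h2, hx.eq_one, hx.eq_one] <;> rw [mem_outerBox] <;> dsimp only <;> omega

theorem exists_torusSite_eq {p : ℤ × ℤ} (hp : p ∈ outerBox m) :
    ∃ t : Fin 2 → ZMod (m + 5), torusSite t = p := by
  rw [mem_outerBox] at hp
  refine ⟨![((p.1 + 2).toNat : ZMod (m + 5)), ((p.2 + 2).toNat : ZMod (m + 5))], ?_⟩
  unfold torusSite
  simp only [Matrix.cons_val_zero, Matrix.cons_val_one]
  rw [ZMod.val_natCast_of_lt (by omega), ZMod.val_natCast_of_lt (by omega)]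
  refine Prod.ext ?_ ?_ <;> simp only <;> omega

theorem icebergAllowed.unit_mul {a b : ℤ} (h : icebergAllowed a b) (ε : ℤˣ) :
    icebergAllowed (ε * a) (ε * b) := by
  unfold icebergAllowed at h ⊢
  rcases Int.units_eq_one_or ε with rfl | rfl
  · simpa using h
  · simp only [Units.val_neg, Units.val_one]
    omega

/-- The torus configuration with the letters of `ε x`. -/
def torusConfig (ε : ℤˣ) (x : plusConfigs M m) (t : Fin 2 → ZMod (m + 5)) : IcebergAlphabet M :=
  ⟨ε * x.1 (torusSite t), by
    have hx := mem_plusConfigs.1 x.2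
    refine mem_icebergAlphabet
      (mul_ne_zero ε.ne_zero (hx.horizontal (torusSite t)).ne_zero) ?_
    have hε : |(ε : ℤ)| = 1 := by rcases Int.units_eq_one_or ε with rfl | rfl <;> simp
    rw [abs_mul, hε, one_mul]
    exact hx.abs_le _⟩

theorem torusConfig_injective (ε : ℤˣ) :
    Function.Injective (torusConfig ε : plusConfigs M m → _) := by
  intro x y h
  apply Subtype.ext
  funext p
  by_cases hp : p ∈ outerBox m
  · obtain ⟨t, rfl⟩ := exists_torusSite_eq hp
    have := congrArg Subtype.val (congrFun h t)
    exact mul_left_cancel₀ ε.ne_zero this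
  · rw [(mem_plusConfigs.1 x.2).eq_one p hp, (mem_plusConfigs.1 y.2).eq_one p hp]

open scoped Classical in
/-- The legal configurations on the torus of side `m + 5` at least three quarters of whose letters
have the sign `ε`. -/
noncomputable def biasedTorusConfigs (M m : ℕ) (ε : ℤˣ) :
    Finset ((Fin 2 → ZMod (m + 5)) → IcebergAlphabet M) :=
  Finset.univ.filter fun y =>
    (∀ i t, icebergAllowed (y t).1 (y (t + Pi.single i 1)).1) ∧
      3 / 4 * ((m + 5 : ℕ) : ℝ) ^ 2 ≤ {t | y t ∈ {a : IcebergAlphabet M | 0 < (ε : ℤ) * a.1}}.ncard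

theorem mem_biasedTorusConfigs {ε : ℤˣ} {y : (Fin 2 → ZMod (m + 5)) → IcebergAlphabet M} :
    y ∈ biasedTorusConfigs M m ε ↔
      (∀ i t, icebergAllowed (y t).1 (y (t + Pi.single i 1)).1) ∧
      3 / 4 * ((m + 5 : ℕ) : ℝ) ^ 2
        ≤ {t | y t ∈ {a : IcebergAlphabet M | 0 < (ε : ℤ) * a.1}}.ncard := by
  classical
  simp only [biasedTorusConfigs, Finset.mem_filter, Finset.mem_univ, true_and]

theorem torusConfig_mem_biasedTorusConfigs {x : plusConfigs M m} (ε : ℤˣ)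
    (hx : 4 * {t : Fin 2 → ZMod (m + 5) | x.1 (torusSite t) < 0}.ncard ≤ (m + 5) ^ 2) :
    torusConfig ε x ∈ biasedTorusConfigs M m ε := by
  classical
  have hxp := mem_plusConfigs.1 x.2
  rw [mem_biasedTorusConfigs]
  refine ⟨?_, ?_⟩
  · intro i t
    refine icebergAllowed.unit_mul ?_ ε
    fin_cases i
    · have := hxp.horizontal (torusSite t)
      rw [← hxp.apply_torusSite_zero] at this
      exact this
    · have := hxp.vertical (torusSite t)
      rw [← hxp.apply_torusSite_one] at this
      exact this
  · have h1 : {t | torusConfig ε x t ∈ {a : IcebergAlphabet M | 0 < (ε : ℤ) * a.1}}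
        = {t | x.1 (torusSite t) < 0}ᶜ := by
      ext t
      have h0 := (hxp.horizontal (torusSite t)).ne_zero
      change 0 < (ε : ℤ) * ((ε : ℤ) * x.1 (torusSite t)) ↔ ¬ x.1 (torusSite t) < 0
      rw [← mul_assoc, ← Units.val_mul, Int.units_mul_self, Units.val_one, one_mul]
      omega
    have h2 := Set.ncard_add_ncard_compl {t : Fin 2 → ZMod (m + 5) | x.1 (torusSite t) < 0}
    rw [Nat.card_eq_fintype_card, Fintype.card_fun, ZMod.card, Fintype.card_fin] at h2
    have h3 : ({t : Fin 2 → ZMod (m + 5) | x.1 (torusSite t) < 0}.ncard : ℝ)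
        + ({t : Fin 2 → ZMod (m + 5) | x.1 (torusSite t) < 0}ᶜ.ncard : ℝ)
        = ((m + 5 : ℕ) : ℝ) ^ 2 := by exact_mod_cast h2
    have h4 : 4 * ({t : Fin 2 → ZMod (m + 5) | x.1 (torusSite t) < 0}.ncard : ℝ)
        ≤ ((m + 5 : ℕ) : ℝ) ^ 2 := by exact_mod_cast hx
    rw [h1]
    linarith

/-- Markov's inequality: on average at most `1/16` of the sites are negative, so at most a quarter
of the configurations have more than a quarter of negative sites. The others inject into the biased
ensemble. -/
theorem card_plusConfigs_le (hM : 5508 ≤ M) (m : ℕ) (ε : ℤˣ) :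
    ((plusConfigs M m).card : ℝ) ≤ 2 * (biasedTorusConfigs M m ε).card := by
  classical
  set Ω := plusConfigs M m with hΩ
  set n : (ℤ × ℤ → ℤ) → ℕ :=
    fun x => (Finset.univ.filter fun t : Fin 2 → ZMod (m + 5) => x (torusSite t) < 0).card with hn
  have hN : (0 : ℝ) < ((m + 5 : ℕ) : ℝ) ^ 2 := by positivity
  have hsum : ∑ x ∈ Ω, (n x : ℝ) ≤ ((m + 5 : ℕ) : ℝ) ^ 2 * (1 / 16 * Ω.card) := by
    have h1 : ∑ x ∈ Ω, n x
        = ∑ t : Fin 2 → ZMod (m + 5), (Ω.filter fun x => x (torusSite t) < 0).card := by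
      simp only [hn, Finset.card_filter]
      exact Finset.sum_comm
    rw [← Nat.cast_sum, h1, Nat.cast_sum]
    refine (Finset.sum_le_card_nsmul _ _ (1 / 16 * (Ω.card : ℝ))
      fun t _ => card_filter_neg_le hM (torusSite t)).trans (le_of_eq ?_)
    rw [nsmul_eq_mul, Finset.card_univ, Fintype.card_fun, ZMod.card, Fintype.card_fin]
    push_cast
    rfl
  set G := Ω.filter fun x => 4 * n x ≤ (m + 5) ^ 2 with hG
  have hbad : ((Ω.filter fun x => ¬ 4 * n x ≤ (m + 5) ^ 2).card : ℝ)
      * (((m + 5 : ℕ) : ℝ) ^ 2 / 4) ≤ ∑ x ∈ Ω, (n x : ℝ) := by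
    rw [← nsmul_eq_mul]
    refine (Finset.card_nsmul_le_sum _ (fun x => (n x : ℝ)) _ fun x hx => ?_).trans
      (Finset.sum_le_sum_of_subset_of_nonneg (Finset.filter_subset _ _)
        fun _ _ _ => Nat.cast_nonneg _)
    have h1 : (m + 5) ^ 2 ≤ 4 * n x := (not_le.1 (Finset.mem_filter.1 hx).2).le
    have h2 : ((m + 5 : ℕ) : ℝ) ^ 2 ≤ 4 * n x := by exact_mod_cast h1
    linarith
  have hsplit : ((G.card : ℝ)
      + (Ω.filter fun x => ¬ 4 * n x ≤ (m + 5) ^ 2).card) = Ω.card := by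
    have := Finset.card_filter_add_card_filter_not (s := Ω) fun x => 4 * n x ≤ (m + 5) ^ 2
    exact_mod_cast this
  have hbad' : ((Ω.filter fun x => ¬ 4 * n x ≤ (m + 5) ^ 2).card : ℝ)
      ≤ 1 / 4 * Ω.card := by
    refine le_of_mul_le_mul_right ((hbad.trans hsum).trans (le_of_eq ?_))
      (show (0 : ℝ) < ((m + 5 : ℕ) : ℝ) ^ 2 / 4 by positivity)
    ring
  have hGcard : G.card ≤ (biasedTorusConfigs M m ε).card := by
    rw [← Finset.card_attach]
    refine Finset.card_le_card_of_injOn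
      (fun x => torusConfig ε ⟨x.1, (Finset.mem_filter.1 x.2).1⟩) ?_ ?_
    · intro x _
      refine torusConfig_mem_biasedTorusConfigs ε ?_
      have := (Finset.mem_filter.1 x.2).2
      rw [Set.ncard_eq_toFinset_card']
      convert this using 4
      ext t
      simp
    · intro x _ y _ h
      have := torusConfig_injective ε h
      exact Subtype.ext (Subtype.mk.inj this)
  have hGcard' : (G.card : ℝ) ≤ (biasedTorusConfigs M m ε).card := by exact_mod_cast hGcard
  have hΩ0 : (0 : ℝ) ≤ Ω.card := Nat.cast_nonneg _
  linarith

end TorusConfigs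

/-! ### Two measures of maximal entropy. -/

section MultipleMeasures

variable {M : ℕ}

/-- Legality and the density condition are translation-invariant, unlike the plus boundary
condition; this is why the ensemble contains all biased configurations. -/
theorem isTorusEnsemble_biasedTorusConfigs {m : ℕ} (ε : ℤˣ)
    (hne : (biasedTorusConfigs M m ε).Nonempty) : IsTorusEnsemble (biasedTorusConfigs M m ε) where
  nonempty := hne
  translate_mem t y hy := by
    rw [mem_biasedTorusConfigs] at hy ⊢
    refine ⟨fun i s => ?_, hy.2.trans (le_of_eq ?_)⟩
    · have := hy.1 i (t + s)
      rwa [add_assoc] at this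
    · congr 1
      have : {s | y (t + s) ∈ {a : IcebergAlphabet M | 0 < (ε : ℤ) * a.1}}
          = (Equiv.addLeft t) ⁻¹' {s | y s ∈ {a : IcebergAlphabet M | 0 < (ε : ℤ) * a.1}} := rfl
      rw [this, Set.ncard_preimage_of_injective_subset_range (Equiv.addLeft t).injective]
      intro s _
      exact (Equiv.addLeft t).surjective s

theorem nonempty_iceberg_carrier (hM : 0 < M) : (iceberg M).carrier.Nonempty := by
  refine ⟨fun _ => ⟨1, mem_icebergAlphabet one_ne_zero (by rw [abs_one]; omega)⟩, mem_iceberg.2 ?_⟩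
  intro i t
  exact Or.inl ⟨one_pos, one_pos⟩

theorem ncard_languageOfShape_pos {d : ℕ} {A : Type} [Finite A] [TopologicalSpace A]
    {X : Subshift A (Fin d → ℤ)} (hX : X.carrier.Nonempty) (S : Finset (Fin d → ℤ)) :
    0 < (languageOfShape X S).ncard :=
  (Set.ncard_pos (Set.toFinite _)).2 (hX.image _)

/-- The added border and the factor 2 lost in `card_plusConfigs_le` do not affect the growth rate.
-/
theorem tendsto_biased_rate {X : Subshift (IcebergAlphabet M) (Fin 2 → ℤ)} {h : ℝ}
    (hh : HasTopologicalEntropy X h) :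
    Tendsto (fun m : ℕ => (Real.log (languageOfShape X (box fun _ => m)).ncard - Real.log 2)
      / ((m + 5 : ℕ) : ℝ) ^ 2) atTop (𝓝 h) := by
  have h1 := hh.comp (tendsto_const_atTop_pi (d := 2))
  have h2 : Tendsto (fun m : ℕ => (m : ℝ) / (m + 5)) atTop (𝓝 1) := by
    simpa using tendsto_natCast_div_add_atTop (𝕜 := ℝ) (5 : ℝ)
  have h3 : Tendsto (fun m : ℕ => Real.log 2 / ((m : ℝ) + 5) ^ 2) atTop (𝓝 0) := by
    refine Tendsto.const_div_atTop ?_ _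
    exact (tendsto_pow_atTop (two_ne_zero)).comp
      (tendsto_atTop_add_const_right _ _ tendsto_natCast_atTop_atTop)
  have h4 := (h1.mul (h2.pow 2)).sub h3
  rw [one_pow, mul_one, sub_zero] at h4
  refine h4.congr' ?_
  filter_upwards [eventually_gt_atTop 0] with m hm
  have hm' : (m : ℝ) ≠ 0 := by exact_mod_cast hm.ne'
  simp only [Function.comp, Fin.prod_univ_two]
  push_cast
  field_simp

theorem exists_biased_measureOfMaximalEntropy (hM : 5508 ≤ M) (ε : ℤˣ) :
    ∃ μ : Measure ((Fin 2 → ℤ) → IcebergAlphabet M), IsMeasureOfMaximalEntropy (iceberg M) μ ∧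
      3 / 4 ≤ μ.real {x | x 0 ∈ {a : IcebergAlphabet M | 0 < (ε : ℤ) * a.1}} := by
  obtain ⟨h, hh, -⟩ := exists_hasTopologicalEntropy (iceberg M)
  have hcard : ∀ m : ℕ, ((languageOfShape (iceberg M) (box fun _ => m)).ncard : ℝ)
      ≤ 2 * (biasedTorusConfigs M m ε).card := fun m => by
    refine le_trans ?_ (card_plusConfigs_le hM m ε)
    exact_mod_cast ncard_languageOfShape_le_card_plusConfigs M m
  have hL : ∀ m : ℕ, (0 : ℝ) < (languageOfShape (iceberg M) (box fun _ => m)).ncard := fun m => by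
    exact_mod_cast ncard_languageOfShape_pos (nonempty_iceberg_carrier (by omega)) _
  have hpos : ∀ m : ℕ, (0 : ℝ) < (biasedTorusConfigs M m ε).card := fun m => by
    have := (hL m).trans_le (hcard m)
    linarith
  refine exists_isMeasureOfMaximalEntropy_of_torus _ hh (fun m => m + 5)
    (tendsto_add_atTop_nat 5) (fun m => biasedTorusConfigs M m ε)
    (fun m => isTorusEnsemble_biasedTorusConfigs ε
      (Finset.card_pos.1 (by exact_mod_cast hpos m))) ?_ _ (tendsto_biased_rate hh) ?_ _ _ ?_
  · intro m y hy i t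
    exact not_not.2 ((mem_biasedTorusConfigs.1 hy).1 i t)
  · intro m
    rw [div_mul_cancel₀ _ (by positivity), sub_le_iff_le_add, add_comm,
      ← Real.log_mul two_ne_zero (hpos m).ne']
    exact Real.log_le_log (hL m) (hcard m)
  · intro m y hy
    exact (mem_biasedTorusConfigs.1 hy).2

/-- One measure cannot give mass `3/4` to both of two disjoint events. -/
theorem hasMultipleMME_iceberg (hM : 5508 ≤ M) : HasMultipleMME (iceberg M) := by
  obtain ⟨μ, hμ, hμ'⟩ := exists_biased_measureOfMaximalEntropy hM 1
  obtain ⟨ν, hν, hν'⟩ := exists_biased_measureOfMaximalEntropy hM (-1)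
  refine ⟨μ, ν, hμ, hν, ?_⟩
  rintro rfl
  have := hμ.isProbabilityMeasure
  have hmeas : MeasurableSet {x : (Fin 2 → ℤ) → IcebergAlphabet M |
      x 0 ∈ {a : IcebergAlphabet M | 0 < ((-1 : ℤˣ) : ℤ) * a.1}} :=
    measurable_pi_apply (0 : Fin 2 → ℤ) (Set.toFinite _).measurableSet
  have hdisj : Disjoint {x : (Fin 2 → ℤ) → IcebergAlphabet M |
      x 0 ∈ {a : IcebergAlphabet M | 0 < ((1 : ℤˣ) : ℤ) * a.1}}
      {x | x 0 ∈ {a : IcebergAlphabet M | 0 < ((-1 : ℤˣ) : ℤ) * a.1}} := by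
    rw [Set.disjoint_left]
    intro x h1 h2
    change 0 < ((1 : ℤˣ) : ℤ) * (x 0).1 at h1
    change 0 < ((-1 : ℤˣ) : ℤ) * (x 0).1 at h2
    simp only [Units.val_neg, Units.val_one] at h1 h2
    omega
  have h1 := measureReal_union (μ := μ) hdisj hmeas
  have h2 : μ.real _ ≤ 1 := measureReal_le_one (s := {x : (Fin 2 → ℤ) → IcebergAlphabet M |
      x 0 ∈ {a : IcebergAlphabet M | 0 < ((1 : ℤˣ) : ℤ) * a.1}} ∪
      {x | x 0 ∈ {a : IcebergAlphabet M | 0 < ((-1 : ℤˣ) : ℤ) * a.1}})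
  linarith

end MultipleMeasures

/-! ### Entropy lower bound from a tiling by crosses. -/

section Crosses

variable {M : ℕ}

/-- The position of a site in the cross of the tiling containing it: the centers of the crosses are
the sites `(i, j)` with `i + 2 j` divisible by five. -/
def crossPosition (p : ℤ × ℤ) : Fin 5 := ⟨((p.1 + 2 * p.2) % 5).toNat, by omega⟩

/-- The site at position `r` of the cross centered at `c`. -/
def crossSite (c : ℤ × ℤ) : Fin 5 → ℤ × ℤ :=
  ![c, (c.1 + 1, c.2), (c.1, c.2 + 1), (c.1, c.2 - 1), (c.1 - 1, c.2)]

/-- The center of the cross of the tiling containing `p`. -/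
def crossCenter (p : ℤ × ℤ) : ℤ × ℤ :=
  ![p, (p.1 - 1, p.2), (p.1, p.2 - 1), (p.1, p.2 + 1), (p.1 + 1, p.2)] (crossPosition p)

theorem crossPosition_eq {p : ℤ × ℤ} (r : Fin 5) (h : (p.1 + 2 * p.2) % 5 = (r : ℕ)) :
    crossPosition p = r := by
  apply Fin.ext
  simp only [crossPosition]
  omega

/-- On a cross, `i + 2 j` takes each residue modulo 5 exactly once; hence the crosses tile. -/
theorem crossPosition_crossSite {c : ℤ × ℤ} (hc : (c.1 + 2 * c.2) % 5 = 0) (r : Fin 5) :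
    crossPosition (crossSite c r) = r := by
  apply crossPosition_eq
  fin_cases r <;> simp [crossSite] <;> omega

theorem crossCenter_crossSite {c : ℤ × ℤ} (hc : (c.1 + 2 * c.2) % 5 = 0) (r : Fin 5) :
    crossCenter (crossSite c r) = c := by
  rw [crossCenter, crossPosition_crossSite hc]
  fin_cases r <;> simp [crossSite]

/-- The configuration that shows the pattern `g c` in the cross centered at `c`, where `none` is
the pattern with a letter `-1` surrounded by letters `1`, and `some u` is the positive pattern
with letters `u + 1`. -/
def crossConfig (g : ℤ × ℤ → Option (Fin 5 → Fin M)) (p : ℤ × ℤ) : ℤ :=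
  match g (crossCenter p) with
  | none => if crossPosition p = 0 then -1 else 1
  | some u => ((u (crossPosition p) : ℕ) : ℤ) + 1

theorem crossConfig_ne_zero (g : ℤ × ℤ → Option (Fin 5 → Fin M)) (p : ℤ × ℤ) :
    crossConfig g p ≠ 0 := by
  unfold crossConfig
  split
  · split_ifs <;> simp
  · positivity

theorem abs_crossConfig_le (hM : 0 < M) (g : ℤ × ℤ → Option (Fin 5 → Fin M)) (p : ℤ × ℤ) :
    |crossConfig g p| ≤ M := by
  unfold crossConfig
  split
  · split_ifs <;> simp <;> omega
  · rename_i u _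
    have := (u (crossPosition p)).isLt
    rw [abs_of_pos (by positivity)]
    omega

/-- The neighbors of a negative letter are equal to `1`. -/
theorem crossConfig_of_neg {g : ℤ × ℤ → Option (Fin 5 → Fin M)} {p : ℤ × ℤ}
    (hp : crossConfig g p < 0) :
    crossConfig g p = -1 ∧ ∀ r : Fin 5, r ≠ 0 → crossConfig g (crossSite p r) = 1 := by
  have h0 : crossPosition p = 0 ∧ g (crossCenter p) = none := by
    unfold crossConfig at hp
    split at hp
    · rename_i h
      refine ⟨?_, h⟩
      by_contra h1
      simp [h1] at hp
    · exact absurd hp (not_lt.2 (by positivity))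
  have hc : (p.1 + 2 * p.2) % 5 = 0 := by
    have := congrArg Fin.val h0.1
    simp only [crossPosition, Fin.val_zero] at this
    omega
  have hcc : crossCenter p = p := by
    rw [crossCenter, h0.1]
    rfl
  constructor
  · unfold crossConfig
    rw [h0.2]
    simp [h0.1]
  · intro r hr
    unfold crossConfig
    rw [crossCenter_crossSite hc, crossPosition_crossSite hc, ← hcc, h0.2]
    simp [hr]

/-- `r'` is the direction opposite to `r`, so that either end of the edge can play the role of the
negative letter. -/
theorem icebergAllowed_crossConfig (g : ℤ × ℤ → Option (Fin 5 → Fin M)) (p : ℤ × ℤ)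
    (r r' : Fin 5) (hr : r ≠ 0) (hr' : r' ≠ 0) (hrr' : crossSite (crossSite p r) r' = p) :
    icebergAllowed (crossConfig g p) (crossConfig g (crossSite p r)) := by
  refine icebergAllowed_of_signs (crossConfig_ne_zero g _) (crossConfig_ne_zero g _) fun _ => ?_
  rcases lt_or_ge (crossConfig g p) 0 with h | h
  · obtain ⟨h1, h2⟩ := crossConfig_of_neg h
    simp [h1, h2 r hr]
  · have h' : crossConfig g (crossSite p r) < 0 := by
      have := crossConfig_ne_zero g p
      omega
    obtain ⟨h1, h2⟩ := crossConfig_of_neg h'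
    have h3 := h2 r' hr'
    rw [hrr'] at h3
    simp [h1, h3]

/-- The configuration `crossConfig g` as a point of the full shift over the iceberg alphabet. -/
def crossPoint (hM : 0 < M) (g : ℤ × ℤ → Option (Fin 5 → Fin M)) (t : Fin 2 → ℤ) :
    IcebergAlphabet M :=
  ⟨crossConfig g (t 0, t 1),
    mem_icebergAlphabet (crossConfig_ne_zero g _) (abs_crossConfig_le hM g _)⟩

theorem crossPoint_mem_iceberg (hM : 0 < M) (g : ℤ × ℤ → Option (Fin 5 → Fin M)) :
    crossPoint hM g ∈ (iceberg M).carrier := by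
  rw [mem_iceberg]
  intro i t
  fin_cases i
  · have := icebergAllowed_crossConfig g (t 0, t 1) 1 4 (by decide) (by decide)
      (by simp [crossSite])
    simpa [crossPoint, crossSite] using this
  · have := icebergAllowed_crossConfig g (t 0, t 1) 2 3 (by decide) (by decide)
      (by simp [crossSite])
    simpa [crossPoint, crossSite] using this

/-- The centers of the crosses contained in the square `[1, 5 k + 2]²`. -/
def squareCenter (k : ℕ) (ab : Fin k × Fin (5 * k)) : ℤ × ℤ :=
  (5 * (ab.1 : ℕ) + (3 * (ab.2 : ℕ) + 4) % 5 + 2, (ab.2 : ℕ) + 2)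

theorem squareCenter_injective (k : ℕ) : Function.Injective (squareCenter k) := by
  rintro ⟨a, b⟩ ⟨a', b'⟩ h
  simp only [squareCenter, Prod.mk.injEq] at h
  obtain ⟨h1, h2⟩ := h
  have hb : b = b' := Fin.ext (by omega)
  subst hb
  have ha : a = a' := Fin.ext (by omega)
  rw [ha]

/-- Each row of `[2, 5k + 1]²` contains `k` centers, so `5k²` crosses fit in the box. Their patterns
are chosen independently and can be read back, a negative center signalling `none`. -/
theorem pow_le_ncard_languageOfShape_iceberg (hM : 0 < M) (k : ℕ) :
    (M ^ 5 + 1) ^ (5 * k ^ 2) ≤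
      (languageOfShape (iceberg M) (box fun _ => 5 * k + 2)).ncard := by
  -- The value `none` on the remaining crosses is arbitrary, as every choice is legal.
  let G : (Fin k × Fin (5 * k) → Option (Fin 5 → Fin M)) → ℤ × ℤ → Option (Fin 5 → Fin M) :=
    fun g => Function.extend (squareCenter k) g fun _ => none
  let f : (Fin k × Fin (5 * k) → Option (Fin 5 → Fin M)) →
      languageOfShape (iceberg M) (box fun _ => 5 * k + 2) := fun g =>
    ⟨(box fun _ => 5 * k + 2).restrict (crossPoint hM (G g)),
      Set.mem_image_of_mem _ (crossPoint_mem_iceberg hM (G g))⟩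
  have hf : Function.Injective f := by
    intro g g' h
    funext ab
    set c := squareCenter k ab with hc
    have ha := ab.1.isLt
    have hb := ab.2.isLt
    have hc0 : (c.1 + 2 * c.2) % 5 = 0 := by
      simp only [hc, squareCenter]
      omega
    have hG : ∀ g, G g c = g ab := fun g => (squareCenter_injective k).extend_apply _ _ _
    have hval : ∀ r : Fin 5, crossConfig (G g) (crossSite c r) = crossConfig (G g') (crossSite c r) := by
      intro r
      have hmem : ![(crossSite c r).1, (crossSite c r).2] ∈ box fun _ : Fin 2 => 5 * k + 2 := by
        rw [mem_box]
        have hc1 : 2 ≤ c.1 ∧ c.1 ≤ 5 * k + 1 ∧ 2 ≤ c.2 ∧ c.2 ≤ 5 * k + 1 := by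
          simp only [hc, squareCenter]
          omega
        intro i
        fin_cases r <;> fin_cases i <;> simp [crossSite] <;> omega
      exact congrArg Subtype.val (congrFun (congrArg Subtype.val h) ⟨_, hmem⟩)
    have hval' : ∀ r : Fin 5,
        (match g ab with
          | none => if r = 0 then (-1 : ℤ) else 1
          | some u => ((u r : ℕ) : ℤ) + 1) =
        match g' ab with
          | none => if r = 0 then (-1 : ℤ) else 1
          | some u => ((u r : ℕ) : ℤ) + 1 := by
      intro r
      have := hval r
      unfold crossConfig at this
      rwa [crossCenter_crossSite hc0, crossPosition_crossSite hc0, hG, hG] at this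
    rcases hg : g ab with _ | u <;> rcases hg' : g' ab with _ | u' <;> rw [hg, hg'] at hval'
    · have := hval' 0
      simp only [if_true] at this
      omega
    · have := hval' 0
      simp only [if_true] at this
      omega
    · congr 1
      funext r
      have := hval' r
      apply Fin.ext
      simp only at this
      omega
  have := Nat.card_le_card_of_injective f hf
  rw [Nat.card_coe_set_eq, Nat.card_eq_fintype_card] at this
  simp only [Fintype.card_fun, Fintype.card_option, Fintype.card_fin, Fintype.card_prod] at this
  refine le_trans (le_of_eq ?_) this
  congr 1
  ring

theorem log_add_one_div_five_le_entropy (hM : 0 < M) {h : ℝ}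
    (hh : HasTopologicalEntropy (iceberg M) h) : Real.log ((M : ℝ) ^ 5 + 1) / 5 ≤ h := by
  have h1 : Tendsto (fun k : ℕ => 5 * k + 2) atTop atTop :=
    tendsto_atTop_mono (fun k => by simp only [id]; omega) tendsto_id
  have h2 := hh.comp ((tendsto_const_atTop_pi (d := 2)).comp h1)
  have h3 : Tendsto (fun k : ℕ => (k : ℝ) / (k + 2 / 5)) atTop (𝓝 1) := by
    simpa using tendsto_natCast_div_add_atTop (𝕜 := ℝ) (2 / 5 : ℝ)
  have h4 := (h3.pow 2).mul_const (Real.log ((M : ℝ) ^ 5 + 1) / 5)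
  rw [one_pow, one_mul] at h4
  refine le_of_tendsto_of_tendsto' h4 h2 fun k => ?_
  simp only [Function.comp, Fin.prod_univ_two]
  have h5 : ((M : ℝ) ^ 5 + 1) ^ (5 * k ^ 2)
      ≤ (languageOfShape (iceberg M) (box fun _ => 5 * k + 2)).ncard := by
    exact_mod_cast pow_le_ncard_languageOfShape_iceberg hM k
  have h6 := Real.log_le_log (by positivity) h5
  rw [Real.log_pow] at h6
  rw [le_div_iff₀ (by positivity)]
  refine le_trans (le_of_eq ?_) h6
  push_cast
  field_simp

/-- Bernoulli's inequality `2 ^ x ≤ 1 + x` on `[0, 1]`. It turns `log (1 + M^(-5))` into the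
explicit bound `M^(-5) log 2`. -/
theorem mul_log_two_le_log_one_add {x : ℝ} (h0 : 0 ≤ x) (h1 : x ≤ 1) :
    x * Real.log 2 ≤ Real.log (1 + x) := by
  rw [← Real.log_rpow two_pos]
  refine Real.log_le_log (by positivity) ?_
  have := rpow_one_add_le_one_add_mul_self (s := 1) (by norm_num) h0 h1
  norm_num at this
  exact this

theorem exists_iceberg_entropy_ge (hM : 0 < M) : ∃ h : ℝ, HasTopologicalEntropy (iceberg M) h ∧
    h ≥ Real.log (M : ℝ) + Real.log 2 / (5 * (M : ℝ) ^ 5) := by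
  obtain ⟨h, hh, -⟩ := exists_hasTopologicalEntropy (iceberg M)
  refine ⟨h, hh, le_trans ?_ (log_add_one_div_five_le_entropy hM hh)⟩
  have hM1 : (1 : ℝ) ≤ M := by exact_mod_cast hM
  have hM0 : (0 : ℝ) < (M : ℝ) ^ 5 := by positivity
  have h1 : (M : ℝ) ^ 5 + 1 = (M : ℝ) ^ 5 * (1 + 1 / (M : ℝ) ^ 5) := by field_simp
  have h2 := mul_log_two_le_log_one_add (x := 1 / (M : ℝ) ^ 5) (by positivity)
    ((div_le_one hM0).2 (one_le_pow₀ hM1))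
  rw [h1, Real.log_mul hM0.ne' (by positivity), Real.log_pow]
  have h3 : Real.log 2 / (5 * (M : ℝ) ^ 5) = 1 / (M : ℝ) ^ 5 * Real.log 2 / 5 := by field_simp
  rw [h3]
  push_cast
  linarith

end Crosses

/-! ### Bounds for `alpha`. -/

section Alpha

/-- There are at most `|A|` to the volume patterns on a box, so `h ≤ log |A|`. -/
theorem zero_mem_lowerBounds_alphaSet (d : ℕ) : (0 : ℝ) ∈ lowerBounds (alphaSet d) := by
  rintro α ⟨A, _, _, _, _, _, F, ⟨x, -⟩, -, h, hh, hα⟩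
  have hA : Nonempty A := ⟨x 0⟩
  suffices h ≤ Real.log (Fintype.card A) by linarith
  refine le_of_tendsto hh ?_
  filter_upwards [eventually_pos_apply] with n hn
  have hpos : (0 : ℝ) < ∏ i, (n i : ℝ) := Finset.prod_pos fun i _ => by exact_mod_cast hn i
  rw [div_le_iff₀ hpos]
  have hcard : (languageOfShape (nearestNeighborSFT F) (box n)).ncard
      ≤ Fintype.card A ^ ∏ i, n i := by
    refine (Set.ncard_le_card _).trans (le_of_eq ?_)
    rw [Nat.card_eq_fintype_card, Fintype.card_fun, Fintype.card_coe, box, Fintype.card_piFinset]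
    simp
  rcases Nat.eq_zero_or_pos (languageOfShape (nearestNeighborSFT F) (box n)).ncard with h0 | h0
  · rw [h0, Nat.cast_zero, Real.log_zero]
    exact mul_nonneg (Real.log_natCast_nonneg _) hpos.le
  · have h1 : ((languageOfShape (nearestNeighborSFT F) (box n)).ncard : ℝ)
        ≤ (Fintype.card A : ℝ) ^ ∏ i, n i := by exact_mod_cast hcard
    have h2 := Real.log_le_log (by exact_mod_cast h0) h1
    rw [Real.log_pow] at h2
    push_cast at h2
    linarith

theorem card_icebergAlphabet (M : ℕ) : Fintype.card (IcebergAlphabet M) = 2 * M := by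
  rw [Fintype.card_coe, Finset.card_erase_of_mem (by simp), Int.card_Icc]
  omega

theorem mem_alphaSet_two {M : ℕ} (hM : 5508 ≤ M) :
    Real.log 2 - Real.log 2 / (5 * (M : ℝ) ^ 5) ∈ alphaSet 2 := by
  obtain ⟨h, hh, hge⟩ := exists_iceberg_entropy_ge (M := M) (by omega)
  refine ⟨IcebergAlphabet M, inferInstance, inferInstance, inferInstance, inferInstance,
    inferInstance, fun _ => {p | ¬ icebergAllowed p.1 p.2},
    nonempty_iceberg_carrier (M := M) (by omega), hasMultipleMME_iceberg hM, h, hh, ?_⟩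
  have hM0 : (M : ℝ) ≠ 0 := by
    have : M ≠ 0 := by omega
    exact_mod_cast this
  rw [card_icebergAlphabet]
  push_cast
  rw [Real.log_mul two_ne_zero hM0]
  linarith

end Alpha

theorem theorem5p3 :
    IsGLB (alphaSet 2) (alpha 2) ∧
    alpha 2 < Real.log 2 ∧
    alpha 2 ≤ Real.log 2 - Real.log 2 / (5 * 10 ^ 20) ∧
    (∀ M : ℕ, 0 < M → ∃ h : ℝ, HasTopologicalEntropy (iceberg M) h ∧
      h ≥ Real.log (M : ℝ) + Real.log 2 / (5 * (M : ℝ) ^ 5)) ∧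
    (∀ M : ℕ, (M : ℝ) > 4 * Real.exp 1 * 28 ^ 2 → HasMultipleMME (iceberg M)) := by
  have hmem : Real.log 2 - Real.log 2 / (5 * 10 ^ 20) ∈ alphaSet 2 := by
    -- The constant `10 ^ 20` is `M ^ 5` for `M = 10 ^ 4`.
    have := mem_alphaSet_two (M := 10 ^ 4) (by norm_num)
    convert this using 3
    norm_num
  have hglb : IsGLB (alphaSet 2) (alpha 2) :=
    isGLB_csInf ⟨_, hmem⟩ ⟨0, zero_mem_lowerBounds_alphaSet 2⟩
  have hle := hglb.1 hmem
  have hlog : 0 < Real.log 2 / (5 * 10 ^ 20) := div_pos (Real.log_pos one_lt_two) (by norm_num)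
  refine ⟨hglb, by linarith, hle, fun M hM => exists_iceberg_entropy_ge hM, fun M hM => ?_⟩
  refine hasMultipleMME_iceberg ?_
  -- `4e · 28²` exceeds 8500, well above the threshold 5508 obtained here.
  have he := Real.exp_one_gt_d9
  have : (5508 : ℝ) ≤ M := by linarith
  exact_mod_cast this
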